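/- Identify $\mathbb{R}^2$ with $\mathbb{C}$ via $x=x_1+ix_2$, let $x\cdot y=\operatorname{Re}(\bar x y)$, and let $J=\begin{pmatrix}0&1\\-1&0\end{pmatrix}$, $a^0(x)=-\frac12 Jx$, $\Delta_{a^0}=(\nabla-ia^0)\cdot(\nabla-ia^0)$. For $\operatorname{Im}\tau>0$ let $$\mathcal{L}_\tau=\sqrt{\tfrac{2\pi}{\operatorname{Im}\tau}}\,(\mathbb{Z}+\tau\mathbb{Z}),\qquad \mathcal{L}_\tau^*=\{t\in\mathbb{C}: t\cdot s\in 2\pi\mathbb{Z}\ \text{ for all } s\in\mathcal{L}_\tau\},$$ and let $\langle f\rangle=\frac1{|\Omega_\tau|}\int_{\Omega_\tau}f$ be the mean value over a fundamental cell $\Omega_\tau$ of $\mathcal{L}_\tau$. **Theorem.** Let $\operatorname{Im}\tau>0$. For every $k\in\mathbb{C}$ (in particular for $k$ in a fundamental cell of $\mathcal{L}^*_\tau$) there is a $C^2$ function $\phi_k:\mathbb{R}^2\to\mathbb{C}$, unique up to multiplication by a constant of modulus one, such that $$(-\Delta_{a^0}-1)\phi_k=0,\qquad \langle|\phi_k|^2\rangle=1,$$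 $$\phi_k(x+s)=(-1)^{mn}e^{\frac i2 s\cdot Jx}\,e^{ik\cdot s}\,\phi_k(x)\quad\text{for all } x \text{ and all } s=\sqrt{\tfrac{2\pi}{\operatorname{Im}\tau}}\,(m+n\tau),\ m,n\in\mathbb{Z}.$$ For any choice of these functions, the quantity $$\gamma_k(\tau)=2\langle|\phi_0|^2|\phi_k|^2\rangle+\bigl|\langle\phi_0^2\,\bar\phi_k\,\bar\phi_{-k}\rangle\bigr|-\langle|\phi_0|^4\rangle$$ satisfies, for every $k\in\mathbb{C}$, $$\gamma_k(\tau)=2\sum_{t\in\mathcal{L}_\tau^*}e^{-\frac12|t|^2}\cos[\operatorname{Im}(\bar kt)]+\Bigl|\sum_{t\in\mathcal{L}_\tau^*}e^{-\frac12|t+k|^2+i\operatorname{Im}(\bar kt)}\Bigr|-\sum_{t\in\mathcal{L}_\tau^*}e^{-\frac12|t|^2},$$ where all the series converge absolutely. -/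

import Mathlib

open MeasureTheory
open scoped ComplexConjugate

noncomputable section

namespace Abrikosov

/-! The plane `ℝ²` is identified with `ℂ` through `x = x₁ + i x₂`; the Euclidean dot product
`x · y` is then `inner ℝ x y`, and `volume` on `ℂ` is planar Lebesgue measure. -/

/-- The matrix `J = ((0, 1), (-1, 0))` acting on the plane: `J x = (x₂, -x₁)`. -/
def J (x : ℂ) : ℂ := ⟨x.im, -x.re⟩

/-- The vector potential `a⁰(x) = -(1/2) J x` of the constant magnetic field `1`. -/
def a0 (x : ℂ) : ℂ := -(1 / 2 : ℝ) • J x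

/-- The covariant derivative `(v · (∇ - iA)) φ` in the direction `v`. -/
def covDeriv (A : ℂ → ℂ) (v : ℂ) (φ : ℂ → ℂ) (x : ℂ) : ℂ :=
  fderiv ℝ φ x v - Complex.I * ((inner ℝ (A x) v : ℝ) : ℂ) * φ x

/-- The covariant Laplacian `Δ_A = (∇ - iA) · (∇ - iA)`; the coordinate directions are
`1` and `i`. -/
def covLaplacian (A : ℂ → ℂ) (φ : ℂ → ℂ) (x : ℂ) : ℂ :=
  covDeriv A 1 (covDeriv A 1 φ) x + covDeriv A Complex.I (covDeriv A Complex.I φ) x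

/-- The point `√(2π / Im τ) (u + v τ)` with real coordinates `u, v`. -/
def point (τ : ℂ) (u v : ℝ) : ℂ :=
  (Real.sqrt (2 * Real.pi / τ.im) : ℂ) * ((u : ℂ) + (v : ℂ) * τ)

/-- The lattice `L_τ = √(2π / Im τ) (ℤ + τ ℤ)`. -/
def lattice (τ : ℂ) : Set ℂ := {s | ∃ m n : ℤ, s = point τ m n}

/-- The dual lattice `L*_τ`: all `t` with `t · s ∈ 2πℤ` for every `s ∈ L_τ`. -/
def dualLattice (τ : ℂ) : Set ℂ :=
  {t | ∀ s ∈ lattice τ, ∃ n : ℤ, (inner ℝ t s : ℝ) = 2 * Real.pi * (n : ℝ)}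

/-- The fundamental cell `Ω_τ` of `L_τ` spanned by the two generators. -/
def cell (τ : ℂ) : Set ℂ :=
  {x | ∃ u ∈ Set.Ico (0 : ℝ) 1, ∃ v ∈ Set.Ico (0 : ℝ) 1, x = point τ u v}

/-- `φ` is a normalized solution with quasimomentum `k`: a classical solution of
`(-Δ_{a⁰} - 1) φ = 0` with `φ (x + s) = (-1)^{mn} e^{(i/2) s · J x} e^{i k · s} φ x` for
all `s = √(2π / Im τ) (m + n τ)` in `L_τ`, and with mean value of `|φ|²` over a cell equal to `1`.
The sign `(-1)^{mn}` makes the multipliers a cocycle. It is `1` on both generators. -/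
structure IsNormalizedSolution (τ k : ℂ) (φ : ℂ → ℂ) : Prop where
  contDiff : ContDiff ℝ 2 φ
  eigen : ∀ x, -covLaplacian a0 φ x - φ x = 0
  quasiPeriodic : ∀ m n : ℤ, ∀ x : ℂ,
    φ (x + point τ m n) =
      (-1 : ℂ) ^ (m * n)
        * Complex.exp (Complex.I * (((1 / 2) * inner ℝ (point τ m n) (J x) : ℝ) : ℂ))
        * Complex.exp (Complex.I * ((inner ℝ k (point τ m n) : ℝ) : ℂ)) * φ x
  normalized : (⨍ x in cell τ, ‖φ x‖ ^ 2) = 1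

/-- `γ_k(τ) = 2⟨|φ₀|²|φ_k|²⟩ + |⟨φ₀² φ̄_k φ̄_{-k}⟩| - ⟨|φ₀|⁴⟩`, where `⟨·⟩` is the mean value over a
fundamental cell, for a family `φ` of functions indexed by the quasimomentum. -/
def gammaK (τ : ℂ) (φ : ℂ → ℂ → ℂ) (k : ℂ) : ℝ :=
  2 * (⨍ x in cell τ, ‖φ 0 x‖ ^ 2 * ‖φ k x‖ ^ 2)
    + ‖⨍ x in cell τ, φ 0 x ^ 2 * conj (φ k x) * conj (φ (-k) x)‖
    - ⨍ x in cell τ, ‖φ 0 x‖ ^ 4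

end Abrikosov

end

/-! With `D = ∇ - i a⁰`, the annihilation operator `D₁ + i D₂` and the creation operator
`D₁ - i D₂` satisfy `(D₁ - i D₂)(D₁ + i D₂) = Δ_{a⁰} + 1`. For a solution `φ`, the bounded function
`ψ = (D₁ + i D₂) φ` therefore solves `(D₁ - i D₂) ψ = 0` and vanishes by Liouville's theorem, so
`e^{|x|² / 4} φ` is entire. For quasimomentum zero the quasi-periodicity makes it, up to an explicit
factor, an entire function with the functional equation of the Jacobi theta function, whose Fourier
coefficients are determined by a single one of them. The magnetic translation by `i k` carries
quasimomentum zero to quasimomentum `k`.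

Every lattice-periodic function `e^{-i k · x} φ̄₀ φ_k` is a product of two theta functions. Fixing
the difference of the indices of the double series and applying Poisson summation to the remaining
index gives its Fourier series: the coefficient at `t` in the dual lattice is, up to a sign,
`e^{-|t + k|² / 4 + (i / 2) Im(k̄ t)}`. All means in `γ_k` then follow from Parseval's identity. -/

namespace Abrikosov

open Complex
open scoped Real

theorem J_eq (x : ℂ) : J x = -I * x := by
  apply Complex.ext <;> simp [J]

theorem a0_eq (x : ℂ) : a0 x = I / 2 * x := by
  rw [a0, J_eq, real_smul]
  push_cast
  ring

theorem inner_a0 (x v : ℂ) : inner ℝ (a0 x) v = (x.re * v.im - x.im * v.re) / 2 := by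
  simp only [a0, real_inner_smul_left, J, Complex.inner, mul_re, conj_re, conj_im]
  ring

section CovariantDerivative

variable {A φ ψ : ℂ → ℂ} {x : ℂ}

theorem covDeriv_add (v : ℂ) (hφ : DifferentiableAt ℝ φ x) (hψ : DifferentiableAt ℝ ψ x) :
    covDeriv A v (φ + ψ) x = covDeriv A v φ x + covDeriv A v ψ x := by
  simp only [covDeriv, fderiv_add hφ hψ, add_apply, Pi.add_apply]
  ring

theorem covDeriv_const_smul (c v : ℂ) (hφ : DifferentiableAt ℝ φ x) :
    covDeriv A v (c • φ) x = c * covDeriv A v φ x := by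
  simp only [covDeriv, fderiv_const_smul hφ, smul_apply, Pi.smul_apply, smul_eq_mul]
  ring

theorem hasFDerivAt_covDeriv (v : ℂ) (hA : DifferentiableAt ℝ A x) (hφ : ContDiff ℝ 2 φ) :
    HasFDerivAt (covDeriv A v φ)
      ((fderiv ℝ (fderiv ℝ φ) x).flip v
        - I • (((inner ℝ (A x) v : ℝ) : ℂ) • fderiv ℝ φ x
          + φ x • ofRealCLM.comp ((innerSL ℝ v).comp (fderiv ℝ A x)))) x := by
  have hφ' : HasFDerivAt (fun y => fderiv ℝ φ y v) ((fderiv ℝ (fderiv ℝ φ) x).flip v) x :=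
    (ContinuousLinearMap.apply ℝ ℂ v).hasFDerivAt.comp x
      ((hφ.fderiv_right (m := 1) (by norm_num)).differentiable one_ne_zero x).hasFDerivAt
  have hA' : HasFDerivAt (fun y => ((inner ℝ (A y) v : ℝ) : ℂ))
      (ofRealCLM.comp ((innerSL ℝ v).comp (fderiv ℝ A x))) x := by
    simp only [real_inner_comm v]
    exact ofRealCLM.hasFDerivAt.comp x ((innerSL ℝ v).hasFDerivAt.comp x hA.hasFDerivAt)
  have h := hφ'.sub ((hA'.mul (hφ.differentiable two_ne_zero x).hasFDerivAt).const_mul I)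
  exact h.congr_of_eventuallyEq (.of_forall fun y => by simp [covDeriv, mul_assoc])

theorem covDeriv_commutator (v w : ℂ) (hA : DifferentiableAt ℝ A x) (hφ : ContDiff ℝ 2 φ) :
    covDeriv A v (covDeriv A w φ) x - covDeriv A w (covDeriv A v φ) x
      = -I * ((inner ℝ (fderiv ℝ A x v) w - inner ℝ (fderiv ℝ A x w) v : ℝ) : ℂ) * φ x := by
  have hD (v w : ℂ) : covDeriv A v (covDeriv A w φ) x
      = fderiv ℝ (fderiv ℝ φ) x v w
        - I * ((inner ℝ (A x) w : ℝ) * fderiv ℝ φ x v + φ x * (inner ℝ (fderiv ℝ A x v) w : ℝ))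
        - I * (inner ℝ (A x) v : ℝ) * (fderiv ℝ φ x w - I * (inner ℝ (A x) w : ℝ) * φ x) := by
    rw [covDeriv, (hasFDerivAt_covDeriv w hA hφ).fderiv, covDeriv]
    simp only [sub_apply, smul_apply, add_apply, ContinuousLinearMap.flip_apply, smul_eq_mul,
      ContinuousLinearMap.comp_apply, ofRealCLM_apply, innerSL_apply_apply, real_inner_comm w]
  have hsymm : fderiv ℝ (fderiv ℝ φ) x v w = fderiv ℝ (fderiv ℝ φ) x w v :=
    hφ.contDiffAt.isSymmSndFDerivAt (by simp) v w
  rw [hD, hD, hsymm]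
  push_cast
  ring

end CovariantDerivative

section LandauLevels

theorem hasFDerivAt_a0 (x : ℂ) :
    HasFDerivAt a0 (((I / 2) • ContinuousLinearMap.id ℂ ℂ).restrictScalars ℝ) x := by
  rw [funext a0_eq]
  exact ((hasFDerivAt_id x).const_mul (I / 2)).restrictScalars ℝ

theorem fderiv_a0 (x v : ℂ) : fderiv ℝ a0 x v = a0 v := by
  simp [(hasFDerivAt_a0 x).fderiv, a0_eq]

/-- The annihilation operator `D₁ + i D₂ = 2∂̄ + x / 2` of the Landau levels, for `D = ∇ - i a⁰`. -/
noncomputable def annihilation (φ : ℂ → ℂ) : ℂ → ℂ := covDeriv a0 1 φ + I • covDeriv a0 I φ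

/-- The creation operator `D₁ - i D₂ = 2∂ - x̄ / 2` of the Landau levels, for `D = ∇ - i a⁰`. -/
noncomputable def creation (φ : ℂ → ℂ) : ℂ → ℂ := covDeriv a0 1 φ - I • covDeriv a0 I φ

variable {φ : ℂ → ℂ}

theorem differentiable_covDeriv_a0 (v : ℂ) (hφ : ContDiff ℝ 2 φ) :
    Differentiable ℝ (covDeriv a0 v φ) :=
  fun x => (hasFDerivAt_covDeriv v (hasFDerivAt_a0 x).differentiableAt hφ).differentiableAt

theorem differentiable_annihilation (hφ : ContDiff ℝ 2 φ) : Differentiable ℝ (annihilation φ) :=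
  (differentiable_covDeriv_a0 1 hφ).add ((differentiable_covDeriv_a0 I hφ).const_smul I)

theorem annihilation_const_smul (c : ℂ) (hφ : Differentiable ℝ φ) :
    annihilation (c • φ) = c • annihilation φ := by
  funext x
  simp only [annihilation, Pi.add_apply, Pi.smul_apply, smul_eq_mul,
    covDeriv_const_smul c _ (hφ x)]
  ring

theorem creation_annihilation (hφ : ContDiff ℝ 2 φ) (x : ℂ) :
    creation (annihilation φ) x = covLaplacian a0 φ x + φ x := by
  have hcomm := covDeriv_commutator 1 I (hasFDerivAt_a0 x).differentiableAt hφ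
  have hcurl : inner ℝ (fderiv ℝ a0 x 1) I - inner ℝ (fderiv ℝ a0 x I) 1 = (1 : ℝ) := by
    rw [fderiv_a0, fderiv_a0, inner_a0, inner_a0]
    norm_num
  have hdist (v : ℂ) : covDeriv a0 v (annihilation φ) x
      = covDeriv a0 v (covDeriv a0 1 φ) x + I * covDeriv a0 v (covDeriv a0 I φ) x := by
    rw [annihilation, covDeriv_add v (differentiable_covDeriv_a0 1 hφ x)
      ((differentiable_covDeriv_a0 I hφ).const_smul I x),
      covDeriv_const_smul I v (differentiable_covDeriv_a0 I hφ x)]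
  rw [hcurl, ofReal_one] at hcomm
  simp only [creation, Pi.sub_apply, Pi.smul_apply, smul_eq_mul, hdist, covLaplacian]
  linear_combination I * hcomm - (covDeriv a0 I (covDeriv a0 I φ) x + φ x) * I_sq

/-- The Cauchy–Riemann operator `∂₁ + i ∂₂`, twice the Wirtinger derivative `∂̄`. -/
noncomputable def dbar (f : ℂ → ℂ) (x : ℂ) : ℂ := fderiv ℝ f x 1 + I * fderiv ℝ f x I

theorem differentiable_complex_iff_dbar_eq_zero {f : ℂ → ℂ} (hf : Differentiable ℝ f) :
    Differentiable ℂ f ↔ ∀ x, dbar f x = 0 := by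
  refine forall_congr' fun x => ?_
  rw [differentiableAt_complex_iff_differentiableAt_real, and_iff_right (hf x), dbar, smul_eq_mul]
  constructor <;> intro h
  · linear_combination I * h + fderiv ℝ f x 1 * I_sq
  · linear_combination -I * h + fderiv ℝ f x I * I_sq

theorem hasFDerivAt_exp_mul_normSq_mul (c : ℝ) {f : ℂ → ℂ} {x : ℂ} (hf : DifferentiableAt ℝ f x) :
    HasFDerivAt (fun y => (Real.exp (c * ‖y‖ ^ 2) : ℂ) * f y)
      ((Real.exp (c * ‖x‖ ^ 2) : ℂ) •
        (fderiv ℝ f x + ((2 * c : ℝ) * f x) • ofRealCLM.comp (innerSL ℝ x))) x := by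
  have hexp : HasFDerivAt (fun y : ℂ => (Real.exp (c * ‖y‖ ^ 2) : ℂ)) _ x :=
    ofRealCLM.hasFDerivAt.comp x ((hasStrictFDerivAt_norm_sq x).hasFDerivAt.const_mul c).exp
  refine (hexp.mul hf.hasFDerivAt).congr_fderiv ?_
  ext v
  simp only [ofReal_exp, ofReal_mul, ofReal_pow, ContinuousLinearMap.comp_smulₛₗ,
    Real.ringHom_apply, ContinuousLinearMap.comp_smul, nsmul_eq_mul, Nat.cast_ofNat, add_apply,
    smul_apply, smul_eq_mul, mul_apply_eq_comp, ContinuousLinearMap.comp_apply, coe_innerSL_apply,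
    Complex.inner, mul_re, conj_re, conj_im, mul_neg, sub_neg_eq_add, ofRealCLM_apply, ofReal_add,
    ContinuousLinearMap.ofNat_apply, smul_add, real_smul, ofReal_ofNat, add_right_inj]
  ring

theorem dbar_exp_mul_normSq_mul (c : ℝ) {f : ℂ → ℂ} {x : ℂ} (hf : DifferentiableAt ℝ f x) :
    dbar (fun y => (Real.exp (c * ‖y‖ ^ 2) : ℂ) * f y) x
      = Real.exp (c * ‖x‖ ^ 2) * (dbar f x + 2 * c * x * f x) := by
  rw [dbar, dbar, (hasFDerivAt_exp_mul_normSq_mul c hf).fderiv]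
  simp only [ofReal_exp, ofReal_mul, ofReal_pow, ofReal_ofNat, smul_add, add_apply, smul_apply,
    smul_eq_mul, ContinuousLinearMap.comp_apply, coe_innerSL_apply, Complex.inner, one_mul, conj_re,
    ofRealCLM_apply, mul_re, I_re, zero_mul, I_im, conj_im, mul_neg, sub_neg_eq_add, zero_add]
  linear_combination (2 * c * exp (c * ‖x‖ ^ 2) * f x) * re_add_im x

theorem differentiable_exp_mul_normSq_mul (c : ℝ) {f : ℂ → ℂ} (hf : Differentiable ℝ f) :
    Differentiable ℝ (fun y => (Real.exp (c * ‖y‖ ^ 2) : ℂ) * f y) :=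
  fun x => (hasFDerivAt_exp_mul_normSq_mul c (hf x)).differentiableAt

theorem annihilation_apply (φ : ℂ → ℂ) (x : ℂ) : annihilation φ x = dbar φ x + x / 2 * φ x := by
  simp only [annihilation, covDeriv, dbar, inner_a0, Pi.add_apply, Pi.smul_apply, smul_eq_mul]
  simp only [one_im, mul_zero, one_re, mul_one, zero_sub, ofReal_div, ofReal_neg, ofReal_ofNat,
    I_im, I_re, sub_zero]
  linear_combination (φ x / 2) * re_add_im x - (x.re / 2 * φ x) * I_sq

theorem conj_creation_apply (hφ : Differentiable ℝ φ) (x : ℂ) :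
    conj (creation φ x) = dbar (fun y => conj (φ y)) x - x / 2 * conj (φ x) := by
  have hconj : HasFDerivAt (fun y => conj (φ y)) (conjCLE.toContinuousLinearMap.comp
      (fderiv ℝ φ x)) x := conjCLE.toContinuousLinearMap.hasFDerivAt.comp x (hφ x).hasFDerivAt
  simp only [creation, covDeriv, dbar, inner_a0, Pi.sub_apply, Pi.smul_apply, smul_eq_mul,
    hconj.fderiv]
  simp only [one_im, mul_zero, one_re, mul_one, zero_sub, ofReal_div, ofReal_neg, ofReal_ofNat,
    I_im, I_re, sub_zero, map_sub, map_mul, conj_I, map_div₀, map_neg, conj_ofReal, map_ofNat,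
    neg_mul, sub_neg_eq_add, ContinuousLinearMap.comp_apply, ContinuousLinearEquiv.coe_coe,
    ContinuousAlgEquiv.coeCLE_apply, conjCAE_apply]
  linear_combination (-conj (φ x) / 2) * re_add_im x + (x.re / 2 * conj (φ x)) * I_sq

theorem annihilation_eq_zero_iff (hφ : Differentiable ℝ φ) :
    annihilation φ = 0 ↔ Differentiable ℂ fun x => (Real.exp (1 / 4 * ‖x‖ ^ 2) : ℂ) * φ x := by
  rw [differentiable_complex_iff_dbar_eq_zero (differentiable_exp_mul_normSq_mul _ hφ), funext_iff]
  refine forall_congr' fun x => ?_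
  rw [dbar_exp_mul_normSq_mul _ (hφ x), mul_eq_zero_iff_left (by simp),
    annihilation_apply]
  push_cast
  ring_nf
  simp

/-- Bounded solutions of the first-order equation vanish by Liouville's theorem: the conjugate of
`e^{-|x|² / 4} φ` is entire and tends to zero at infinity. -/
theorem eq_zero_of_creation_eq_zero (hφ : Differentiable ℝ φ) (hcre : creation φ = 0) {C : ℝ}
    (hC : ∀ x, ‖φ x‖ ≤ C) : φ = 0 := by
  have hφ' : Differentiable ℝ fun x => conj (φ x) :=
    conjCLE.toContinuousLinearMap.differentiable.comp hφ
  set g : ℂ → ℂ := fun x => (Real.exp (-(1 / 4) * ‖x‖ ^ 2) : ℂ) * conj (φ x) with hg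
  have hentire : Differentiable ℂ g := by
    rw [differentiable_complex_iff_dbar_eq_zero (differentiable_exp_mul_normSq_mul _ hφ')]
    intro x
    have hx := conj_creation_apply hφ x
    rw [hcre, Pi.zero_apply, map_zero] at hx
    rw [dbar_exp_mul_normSq_mul _ (hφ' x), mul_eq_zero]
    right
    push_cast
    linear_combination -hx
  have hgauss : Filter.Tendsto (fun x : ℂ => Real.exp (-(1 / 4) * ‖x‖ ^ 2) * C)
      (Filter.cocompact ℂ) (nhds 0) := by
    rw [← zero_mul C]
    refine (Real.tendsto_exp_atBot.comp ?_).mul_const C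
    exact ((Filter.tendsto_pow_atTop two_ne_zero).comp
      (tendsto_norm_cocompact_atTop (E := ℂ))).const_mul_atTop_of_neg (by norm_num)
  have hlim : Filter.Tendsto g (Filter.cocompact ℂ) (nhds 0) := by
    refine squeeze_zero_norm (fun x => ?_) hgauss
    rw [hg, norm_mul, RCLike.norm_conj, norm_real, Real.norm_of_nonneg (Real.exp_pos _).le]
    exact mul_le_mul_of_nonneg_left (hC x) (Real.exp_pos _).le
  funext x
  simpa [hg] using hentire.apply_eq_of_tendsto_cocompact x hlim

end LandauLevels

section MagneticTranslation

/-- The plane wave `x ↦ e^{i t · x}`. -/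
noncomputable def planeWave (t x : ℂ) : ℂ := exp (I * (inner ℝ t x : ℝ))

theorem norm_planeWave (t x : ℂ) : ‖planeWave t x‖ = 1 := by
  rw [planeWave, mul_comm, norm_exp_ofReal_mul_I]

theorem planeWave_zero_left (x : ℂ) : planeWave 0 x = 1 := by simp [planeWave]

theorem planeWave_zero_right (t : ℂ) : planeWave t 0 = 1 := by simp [planeWave]

theorem planeWave_add_left (s t x : ℂ) : planeWave (s + t) x = planeWave s x * planeWave t x := by
  rw [planeWave, planeWave, planeWave, ← exp_add, inner_add_left, ofReal_add, mul_add]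

theorem planeWave_add_right (t x y : ℂ) : planeWave t (x + y) = planeWave t x * planeWave t y := by
  rw [planeWave, planeWave, planeWave, ← exp_add, inner_add_right, ofReal_add, mul_add]

theorem planeWave_mul_planeWave_neg (t x : ℂ) : planeWave t x * planeWave (-t) x = 1 := by
  rw [← planeWave_add_left, add_neg_cancel, planeWave_zero_left]

theorem hasFDerivAt_planeWave (t x : ℂ) :
    HasFDerivAt (planeWave t) (planeWave t x • I • ofRealCLM.comp (innerSL ℝ t)) x :=
  ((ofRealCLM.comp (innerSL ℝ t)).hasFDerivAt.const_mul I).cexp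

theorem contDiff_planeWave (t : ℂ) : ContDiff ℝ 2 (planeWave t) :=
  (contDiff_const.mul (ofRealCLM.comp (innerSL ℝ t)).contDiff).cexp

/-- The magnetic translation `φ ↦ e^{-(i/2) s · J x} φ (x + s)` of the constant field: the
translation by `s` followed by the gauge transformation that restores the potential `a⁰`. Here
`(1/2) s · J x = a⁰(s) · x`. -/
noncomputable def magneticTranslation (s : ℂ) (φ : ℂ → ℂ) (x : ℂ) : ℂ :=
  planeWave (-a0 s) x * φ (x + s)

variable {φ : ℂ → ℂ}

theorem norm_magneticTranslation (s : ℂ) (φ : ℂ → ℂ) (x : ℂ) :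
    ‖magneticTranslation s φ x‖ = ‖φ (x + s)‖ := by
  rw [magneticTranslation, norm_mul, norm_planeWave, one_mul]

theorem magneticTranslation_const_smul (s c : ℂ) (φ : ℂ → ℂ) :
    magneticTranslation s (c • φ) = c • magneticTranslation s φ :=
  funext fun _ => mul_left_comm _ _ _

theorem magneticTranslation_zero (φ : ℂ → ℂ) : magneticTranslation 0 φ = φ := by
  funext x
  simp [magneticTranslation, a0_eq, planeWave_zero_left]

theorem magneticTranslation_comp (s s' : ℂ) (φ : ℂ → ℂ) :
    magneticTranslation s (magneticTranslation s' φ)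
      = planeWave (-a0 s') s • magneticTranslation (s + s') φ := by
  funext x
  simp only [magneticTranslation, Pi.smul_apply, smul_eq_mul, planeWave_add_right, a0_eq, mul_add,
    neg_add, planeWave_add_left, add_assoc]
  ring

theorem magneticTranslation_neg (s : ℂ) (φ : ℂ → ℂ) :
    magneticTranslation s (magneticTranslation (-s) φ) = φ := by
  have hs : inner ℝ (a0 s) s = 0 := by rw [inner_a0]; ring
  rw [magneticTranslation_comp, add_neg_cancel, magneticTranslation_zero, a0_eq, mul_neg, neg_neg,
    ← a0_eq, planeWave, hs, ofReal_zero, mul_zero, exp_zero, one_smul]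

theorem magneticTranslation_comm (s s' : ℂ) (φ : ℂ → ℂ) :
    magneticTranslation s (magneticTranslation s' φ)
      = planeWave (J s') s • magneticTranslation s' (magneticTranslation s φ) := by
  have hphase : planeWave (-a0 s') s = planeWave (J s') s * planeWave (-a0 s) s' := by
    rw [planeWave, planeWave, planeWave, ← exp_add, ← mul_add, ← ofReal_add, inner_neg_left,
      inner_neg_left, inner_a0, inner_a0]
    congr 3
    simp only [J, Complex.inner, mul_re, conj_re, conj_im, neg_neg]
    ring
  rw [magneticTranslation_comp, magneticTranslation_comp, add_comm s', hphase, smul_smul]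

theorem contDiff_magneticTranslation (s : ℂ) (hφ : ContDiff ℝ 2 φ) :
    ContDiff ℝ 2 (magneticTranslation s φ) :=
  (contDiff_planeWave _).mul (hφ.comp (contDiff_id.add contDiff_const))

theorem covDeriv_magneticTranslation (s v : ℂ) (hφ : Differentiable ℝ φ) :
    covDeriv a0 v (magneticTranslation s φ) = magneticTranslation s (covDeriv a0 v φ) := by
  funext x
  have hT : HasFDerivAt (magneticTranslation s φ) _ x :=
    (hasFDerivAt_planeWave (-a0 s) x).mul
      (((hasFDerivAt_comp_add_right s).2 (hφ (x + s)).hasFDerivAt))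
  simp only [covDeriv, magneticTranslation, hT.fderiv, a0_eq, mul_add, inner_add_left, ofReal_add]
  simp only [map_neg, ContinuousLinearMap.comp_neg, smul_neg, add_apply, smul_apply, smul_eq_mul,
    neg_apply, ContinuousLinearMap.comp_apply, coe_innerSL_apply, Complex.inner, map_mul, map_div₀,
    conj_I, mul_re, conj_re, conj_im, mul_neg, sub_neg_eq_add, mul_im, ofRealCLM_apply, ofReal_sub,
    ofReal_mul, ofReal_add, ofReal_neg]
  ring

theorem annihilation_magneticTranslation (s : ℂ) (hφ : Differentiable ℝ φ) :
    annihilation (magneticTranslation s φ) = magneticTranslation s (annihilation φ) := by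
  funext x
  simp only [annihilation, covDeriv_magneticTranslation s _ hφ, magneticTranslation, Pi.add_apply,
    Pi.smul_apply, smul_eq_mul]
  ring

/-- Magnetic Bloch condition with quasimomentum `k`: the magnetic translations by the points
`√(2π / Im τ) (m + n τ)` of the lattice act on `φ` as multiplication by `(-1)^{mn} e^{i k · s}`. -/
def IsQuasiPeriodic (τ k : ℂ) (φ : ℂ → ℂ) : Prop :=
  ∀ m n : ℤ, magneticTranslation (point τ m n) φ
    = ((-1 : ℂ) ^ (m * n) * planeWave k (point τ m n)) • φ

variable {τ k : ℂ}

theorem isQuasiPeriodic_iff : IsQuasiPeriodic τ k φ ↔ ∀ m n : ℤ, ∀ x : ℂ,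
    φ (x + point τ m n) = (-1 : ℂ) ^ (m * n)
      * exp (I * (((1 / 2) * inner ℝ (point τ m n) (J x) : ℝ) : ℂ))
      * exp (I * ((inner ℝ k (point τ m n) : ℝ) : ℂ)) * φ x := by
  refine forall₂_congr fun m n => funext_iff.trans (forall_congr' fun x => ?_)
  have hgauge : exp (I * ((1 / 2 * inner ℝ (point τ m n) (J x) : ℝ) : ℂ))
      = planeWave (a0 (point τ m n)) x := by
    rw [planeWave, inner_a0]
    congr 3
    simp only [one_div, J, Complex.inner, mul_re, conj_re, conj_im, mul_neg, neg_mul, neg_neg]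
    ring
  have hinv := planeWave_mul_planeWave_neg (a0 (point τ m n)) x
  rw [hgauge, magneticTranslation, Pi.smul_apply, smul_eq_mul, planeWave.eq_1 k]
  constructor <;> intro h
  · linear_combination planeWave (a0 (point τ m n)) x * h - φ (x + point τ m n) * hinv
  · rw [h]
    linear_combination (-1 : ℂ) ^ (m * n) * exp (I * (inner ℝ k (point τ m n) : ℝ)) * φ x * hinv

theorem IsQuasiPeriodic.norm_add (h : IsQuasiPeriodic τ k φ) (m n : ℤ) (x : ℂ) :
    ‖φ (x + point τ m n)‖ = ‖φ x‖ := by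
  rw [← norm_magneticTranslation, h m n]
  simp [norm_planeWave]

theorem IsQuasiPeriodic.annihilation (h : IsQuasiPeriodic τ k φ) (hφ : Differentiable ℝ φ) :
    IsQuasiPeriodic τ k (annihilation φ) := fun m n => by
  rw [← annihilation_magneticTranslation _ hφ, h m n, annihilation_const_smul _ hφ]

theorem IsQuasiPeriodic.magneticTranslation (h : IsQuasiPeriodic τ k φ) (k' : ℂ) :
    IsQuasiPeriodic τ (k + k') (magneticTranslation (I * k') φ) := fun m n => by
  have hJ : J (I * k') = k' := by rw [J_eq, ← mul_assoc, neg_mul, I_mul_I, neg_neg, one_mul]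
  rw [magneticTranslation_comm, h m n, magneticTranslation_const_smul, smul_smul, hJ,
    planeWave_add_left]
  congr 1
  ring

end MagneticTranslation

section Average

variable {E F G : Type*} [NormedAddCommGroup E] [NormedSpace ℝ E] [FiniteDimensional ℝ E]
  [MeasurableSpace E] [BorelSpace E] [NormedAddCommGroup F] [NormedSpace ℝ F]
  [MeasurableSpace F] [BorelSpace F] [NormedAddCommGroup G] [NormedSpace ℝ G]

theorem setAverage_image_continuousLinearEquiv (L : E ≃L[ℝ] F) (μ : Measure E) (ν : Measure F)
    [μ.IsAddHaarMeasure] [ν.IsAddHaarMeasure] (s : Set E) (g : F → G) :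
    ⨍ y in L '' s, g y ∂ν = ⨍ x in s, g (L x) ∂μ := by
  have hL : MeasurableEmbedding L := L.toHomeomorph.measurableEmbedding
  have : FiniteDimensional ℝ F := L.toLinearEquiv.finiteDimensional
  have : (μ.map L).IsAddHaarMeasure := L.isAddHaarMeasure_map μ
  set c := Measure.addHaarScalarFactor ν (μ.map L)
  have hν : ν = c • μ.map L := Measure.isAddLeftInvariant_eq_smul ν (μ.map L)
  have hc : (c : ℝ) ≠ 0 :=
    NNReal.coe_ne_zero.2 (Measure.addHaarScalarFactor_pos_of_isAddHaarMeasure ν (μ.map L)).ne'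
  have hpre : L ⁻¹' (L '' s) = s := L.injective.preimage_image s
  rw [setAverage_eq, setAverage_eq, hν, Measure.restrict_smul, integral_smul_nnreal_measure,
    measureReal_nnreal_smul_apply, hL.setIntegral_map, measureReal_def (μ.map L), hL.map_apply,
    hpre, ← measureReal_def, NNReal.smul_def, smul_smul, mul_inv, mul_right_comm,
    inv_mul_cancel₀ hc, one_mul]

end Average

section Lattice

/-- The factor `√(2π / Im τ)` which normalizes the area of the cell to `2π`. -/
noncomputable def scale (τ : ℂ) : ℝ := √(2 * π / τ.im)

/-- The point of the dual lattice with coordinates `p` in the basis dual to the generators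
`point τ 1 0`, `point τ 0 1`, up to the factor `2π`. -/
noncomputable def dualPoint (τ : ℂ) : ℤ × ℤ →+ ℂ where
  toFun p := I * point τ p.2 (-p.1)
  map_zero' := by simp [point]
  map_add' p q := by
    simp only [point, Prod.snd_add, Int.cast_add, ofReal_add, ofReal_intCast, Prod.fst_add,
      neg_add_rev, ofReal_neg, neg_mul]
    ring

variable {τ : ℂ}

theorem scale_pos (hτ : 0 < τ.im) : 0 < scale τ :=
  Real.sqrt_pos.2 (div_pos Real.two_pi_pos hτ)

theorem scale_sq_mul_im (hτ : 0 < τ.im) : scale τ ^ 2 * τ.im = 2 * π := by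
  rw [scale, Real.sq_sqrt (div_pos Real.two_pi_pos hτ).le, div_mul_cancel₀ _ hτ.ne']

theorem point_eq (τ : ℂ) (u v : ℝ) : point τ u v = scale τ * (u + v * τ) := rfl

theorem dualPoint_eq (τ : ℂ) (p : ℤ × ℤ) : dualPoint τ p = I * scale τ * (p.2 - p.1 * τ) := by
  change I * point τ p.2 (-p.1) = _
  rw [point_eq]
  push_cast
  ring

theorem inner_dualPoint (hτ : 0 < τ.im) (p : ℤ × ℤ) (u v : ℝ) :
    inner ℝ (dualPoint τ p) (point τ u v) = 2 * π * (p.1 * u + p.2 * v) := by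
  rw [Complex.inner, ← scale_sq_mul_im hτ, dualPoint_eq, point_eq]
  simp only [map_mul, conj_I, conj_ofReal, neg_mul, map_sub, map_intCast, mul_neg, neg_re, mul_re,
    ofReal_re, add_re, ofReal_im, zero_mul, sub_zero, add_im, mul_im, add_zero, zero_add, I_re,
    I_im, mul_zero, sub_self, sub_re, intCast_re, conj_re, intCast_im, conj_im, neg_zero, one_mul,
    sub_im, sub_neg_eq_add, zero_sub, neg_sub]
  ring

theorem point_eq_zero_iff (hτ : 0 < τ.im) {u v : ℝ} : point τ u v = 0 ↔ u = 0 ∧ v = 0 := by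
  refine ⟨fun h => ?_, fun h => by simp [h, point]⟩
  have hu := inner_dualPoint hτ (1, 0) u v
  have hv := inner_dualPoint hτ (0, 1) u v
  rw [h, inner_zero_right] at hu hv
  constructor
  · simpa [Real.pi_ne_zero] using hu.symm
  · simpa [Real.pi_ne_zero] using hv.symm

/-- The coordinates of the plane in which the cell is the unit square. -/
noncomputable def pointEquiv (hτ : 0 < τ.im) : (ℝ × ℝ) ≃L[ℝ] ℂ :=
  (LinearEquiv.ofInjectiveOfFinrankEq
    { toFun q := point τ q.1 q.2
      map_add' q r := by
        simp only [point, Prod.fst_add, ofReal_add, Prod.snd_add]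
        ring
      map_smul' c q := by
        simp only [point, Prod.smul_fst, smul_eq_mul, ofReal_mul, Prod.smul_snd, Real.ringHom_apply,
          real_smul]
        ring }
    (LinearMap.ker_eq_bot.1 <| LinearMap.ker_eq_bot'.2 fun _ h =>
      Prod.ext_iff.2 ((point_eq_zero_iff hτ).1 h))
    (by simp)).toContinuousLinearEquiv

theorem pointEquiv_apply (hτ : 0 < τ.im) (q : ℝ × ℝ) : pointEquiv hτ q = point τ q.1 q.2 := rfl

theorem exists_eq_point (hτ : 0 < τ.im) (x : ℂ) : ∃ u v : ℝ, x = point τ u v :=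
  ⟨_, _, ((pointEquiv hτ).apply_symm_apply x).symm⟩

theorem range_dualPoint (hτ : 0 < τ.im) : Set.range (dualPoint τ) = dualLattice τ := by
  ext t
  constructor
  · rintro ⟨p, rfl⟩ s ⟨m, n, rfl⟩
    refine ⟨p.1 * m + p.2 * n, ?_⟩
    rw [inner_dualPoint hτ]
    push_cast
    ring
  · intro ht
    obtain ⟨m, hm⟩ := ht (point τ 1 0) ⟨1, 0, by simp⟩
    obtain ⟨l, hl⟩ := ht (point τ 0 1) ⟨0, 1, by simp⟩
    refine ⟨(m, l), ext_inner_right ℝ fun x => ?_⟩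
    obtain ⟨u, v, rfl⟩ := exists_eq_point hτ x
    have hx : point τ u v = u • point τ 1 0 + v • point τ 0 1 := by
      simp only [point, ofReal_one, ofReal_zero, zero_mul, add_zero, mul_one, real_smul, one_mul,
        zero_add]
      ring
    rw [inner_dualPoint hτ, hx, inner_add_right, inner_smul_right_eq_smul,
      inner_smul_right_eq_smul, hm, hl, smul_eq_mul, smul_eq_mul]
    ring

theorem dualPoint_injective (hτ : 0 < τ.im) : Function.Injective (dualPoint τ) := by
  refine (injective_iff_map_eq_zero _).2 fun p hp => ?_
  obtain ⟨h₂, h₁⟩ := (point_eq_zero_iff hτ).1 ((mul_eq_zero.1 hp).resolve_left I_ne_zero)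
  exact Prod.ext (by exact_mod_cast neg_eq_zero.1 h₁) (by exact_mod_cast h₂)

/-- The dual lattice is indexed by pairs of integers. -/
noncomputable def dualEquiv (hτ : 0 < τ.im) : ℤ × ℤ ≃ dualLattice τ :=
  (Equiv.ofInjective _ (dualPoint_injective hτ)).trans (Equiv.setCongr (range_dualPoint hτ))

theorem coe_dualEquiv (hτ : 0 < τ.im) (p : ℤ × ℤ) : (dualEquiv hτ p : ℂ) = dualPoint τ p := rfl

theorem exists_norm_le_of_norm_add_point_eq (hτ : 0 < τ.im) {E : Type*} [NormedAddCommGroup E]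
    {f : ℂ → E} (hf : Continuous f) (h : ∀ m n : ℤ, ∀ x, ‖f (x + point τ m n)‖ = ‖f x‖) :
    ∃ C : ℝ, ∀ x, ‖f x‖ ≤ C := by
  have hK : IsCompact (Set.Icc (0 : ℝ) 1 ×ˢ Set.Icc (0 : ℝ) 1) := isCompact_Icc.prod isCompact_Icc
  obtain ⟨C, hC⟩ := hK.exists_bound_of_continuousOn
    (hf.comp (pointEquiv hτ).continuous).continuousOn
  refine ⟨C, fun x => ?_⟩
  obtain ⟨u, v, rfl⟩ := exists_eq_point hτ x
  have hfract : point τ u v = point τ (Int.fract u) (Int.fract v) + point τ ⌊u⌋ ⌊v⌋ := by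
    rw [← pointEquiv_apply hτ (_, _), ← pointEquiv_apply hτ (_, _), ← pointEquiv_apply hτ (_, _),
      ← map_add, Prod.mk_add_mk, Int.fract_add_floor, Int.fract_add_floor]
  rw [hfract, h]
  exact hC (Int.fract u, Int.fract v)
    ⟨⟨Int.fract_nonneg u, (Int.fract_lt_one u).le⟩, ⟨Int.fract_nonneg v, (Int.fract_lt_one v).le⟩⟩

theorem summable_exp_neg_mul_sq {c : ℝ} (hc : 0 < c) :
    Summable fun n : ℤ => Real.exp (-c * n ^ 2) := by
  have him : 0 < (I * (c / π : ℝ)).im := by simpa using div_pos hc Real.pi_pos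
  refine ((summable_jacobiTheta₂_term_iff 0 _).2 him).norm.congr fun n => ?_
  rw [norm_jacobiTheta₂_term]
  simp only [neg_mul, ofReal_div, mul_im, I_re, div_ofReal_im, ofReal_im, zero_div, mul_zero, I_im,
    div_ofReal_re, ofReal_re, one_mul, zero_add, zero_im, sub_zero, Real.exp_eq_exp, neg_inj]
  field_simp

theorem exists_sq_add_sq_le_norm_dualPoint_sq (hτ : 0 < τ.im) :
    ∃ K : ℝ, 0 < K ∧ ∀ p : ℤ × ℤ, (p.1 : ℝ) ^ 2 + (p.2 : ℝ) ^ 2 ≤ K * ‖dualPoint τ p‖ ^ 2 := by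
  obtain ⟨C, hC, hbound⟩ := ((pointEquiv hτ).symm : ℂ →L[ℝ] ℝ × ℝ).bound
  refine ⟨2 * C ^ 2, by positivity, fun p => ?_⟩
  have hnorm : max |(p.2 : ℝ)| |(p.1 : ℝ)| ≤ C * ‖dualPoint τ p‖ := by
    have h := hbound (pointEquiv hτ ((p.2 : ℝ), -(p.1 : ℝ)))
    have hI : ‖dualPoint τ p‖ = ‖pointEquiv hτ ((p.2 : ℝ), -(p.1 : ℝ))‖ := by
      rw [pointEquiv_apply, dualPoint_eq, point_eq, mul_assoc, norm_mul, norm_I, one_mul]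
      push_cast
      ring_nf
    rwa [ContinuousLinearEquiv.coe_coe, ContinuousLinearEquiv.symm_apply_apply, ← hI,
      Prod.norm_mk, norm_neg, Real.norm_eq_abs, Real.norm_eq_abs] at h
  obtain ⟨h₂, h₁⟩ := max_le_iff.1 hnorm
  linarith [sq_le_sq.2 (h₁.trans (le_abs_self _)), sq_le_sq.2 (h₂.trans (le_abs_self _))]

theorem summable_exp_neg_mul_norm_dualPoint_add_sq (hτ : 0 < τ.im) {c : ℝ} (hc : 0 < c) (k : ℂ) :
    Summable fun p => Real.exp (-c * ‖dualPoint τ p + k‖ ^ 2) := by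
  obtain ⟨K, hK, hlower⟩ := exists_sq_add_sq_le_norm_dualPoint_sq hτ
  have hs := summable_exp_neg_mul_sq (c := c / 2 / K) (by positivity)
  refine Summable.of_nonneg_of_le (fun _ => (Real.exp_pos _).le) (fun p => ?_)
    ((hs.mul_of_nonneg hs (fun _ => (Real.exp_pos _).le)
      (fun _ => (Real.exp_pos _).le)).mul_left (Real.exp (c * ‖k‖ ^ 2)))
  rw [← Real.exp_add, ← Real.exp_add, Real.exp_le_exp]
  have htri : ‖dualPoint τ p‖ ^ 2 ≤ 2 * ‖dualPoint τ p + k‖ ^ 2 + 2 * ‖k‖ ^ 2 := by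
    have := norm_sub_le (dualPoint τ p + k) k
    rw [add_sub_cancel_right] at this
    nlinarith [norm_nonneg (dualPoint τ p), sq_nonneg (‖dualPoint τ p + k‖ - ‖k‖)]
  have hquad : c / 2 / K * ((p.1 : ℝ) ^ 2 + (p.2 : ℝ) ^ 2) ≤ c / 2 * ‖dualPoint τ p‖ ^ 2 := by
    rw [div_mul_eq_mul_div, mul_div_assoc]
    exact mul_le_mul_of_nonneg_left (by rw [div_le_iff₀' hK]; exact hlower p) (by positivity)
  nlinarith

end Lattice

section Means

variable {τ : ℂ}

theorem average_cell (hτ : 0 < τ.im) {E : Type*} [NormedAddCommGroup E] [NormedSpace ℝ E]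
    (g : ℂ → E) :
    ⨍ x in cell τ, g x = ∫ q in Set.Ico (0 : ℝ) 1 ×ˢ Set.Ico (0 : ℝ) 1, g (point τ q.1 q.2) := by
  have hcell : cell τ = pointEquiv hτ '' (Set.Ico (0 : ℝ) 1 ×ˢ Set.Ico (0 : ℝ) 1) := by
    ext x
    simp [cell, pointEquiv_apply, and_assoc, eq_comm]
  have hvol : (volume : Measure (ℝ × ℝ)).real (Set.Ico (0 : ℝ) 1 ×ˢ Set.Ico (0 : ℝ) 1) = 1 := by
    simp [measureReal_def, Measure.volume_eq_prod]
  rw [hcell, setAverage_image_continuousLinearEquiv _ volume, setAverage_eq, hvol, inv_one,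
    one_smul]
  rfl

theorem setIntegral_exp_two_pi_int_mul (m : ℤ) :
    ∫ u in Set.Ico (0 : ℝ) 1, exp (2 * π * I * m * u) = if m = 0 then 1 else 0 := by
  rw [integral_Ico_eq_integral_Ioc, ← intervalIntegral.integral_of_le zero_le_one]
  split_ifs with h
  · simp [h]
  · have hc : 2 * π * I * m ≠ 0 := by simp [Real.pi_ne_zero, h]
    rw [integral_exp_mul_complex hc, ofReal_one, mul_one, ofReal_zero, mul_zero, exp_zero,
      mul_comm _ (m : ℂ), exp_int_mul_two_pi_mul_I, sub_self, zero_div]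

theorem average_planeWave_dualPoint (hτ : 0 < τ.im) (p : ℤ × ℤ) :
    ⨍ x in cell τ, planeWave (dualPoint τ p) x = if p = 0 then 1 else 0 := by
  have hprod (q : ℝ × ℝ) : planeWave (dualPoint τ p) (point τ q.1 q.2)
      = exp (2 * π * I * p.1 * q.1) * exp (2 * π * I * p.2 * q.2) := by
    rw [planeWave, inner_dualPoint hτ, ← exp_add]
    congr 1
    push_cast
    ring
  simp only [average_cell hτ, hprod, Measure.volume_eq_prod]
  rw [setIntegral_prod_mul (fun u : ℝ => exp (2 * π * I * p.1 * u))
    (fun u : ℝ => exp (2 * π * I * p.2 * u)), setIntegral_exp_two_pi_int_mul,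
    setIntegral_exp_two_pi_int_mul, ite_zero_mul_ite_zero, one_mul]
  simp only [Prod.ext_iff, Prod.fst_zero, Prod.snd_zero]

theorem hasSum_average_cell (hτ : 0 < τ.im) {ι : Type*} [Countable ι] {A : ι → ℂ}
    {d : ι → ℤ × ℤ} {U : ℂ → ℂ} (hA : Summable fun i => ‖A i‖)
    (hU : ∀ x, HasSum (fun i => A i * planeWave (dualPoint τ (d i)) x) (U x)) :
    HasSum (fun i => if d i = 0 then A i else 0) (⨍ x in cell τ, U x) := by
  have hterm (i : ι) : (if d i = 0 then A i else 0)
      = ⨍ x in cell τ, A i * planeWave (dualPoint τ (d i)) x := by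
    rw [average, integral_const_mul, ← average, average_planeWave_dualPoint hτ, mul_ite, mul_one,
      mul_zero]
  have : IsFiniteMeasure (volume.restrict (Set.Ico (0 : ℝ) 1 ×ˢ Set.Ico (0 : ℝ) 1)) := by
    rw [Measure.volume_eq_prod, ← Measure.prod_restrict]
    infer_instance
  simp only [hterm, average_cell hτ]
  refine hasSum_integral_of_dominated_convergence (fun i _ => ‖A i‖) (fun i => ?_)
    (fun i => .of_forall fun q => by rw [norm_mul, norm_planeWave, mul_one])
    (.of_forall fun _ => hA) (integrable_const _) (.of_forall fun q => hU _)
  exact (continuous_const.mul ((contDiff_planeWave _).continuous.comp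
    (pointEquiv hτ).continuous)).aestronglyMeasurable

/-- Parseval's identity for absolutely convergent Fourier series on the cell. -/
theorem hasSum_average_cell_mul (hτ : 0 < τ.im) {A B : ℤ × ℤ → ℂ} {U V : ℂ → ℂ}
    (hA : Summable fun p => ‖A p‖) (hB : Summable fun p => ‖B p‖)
    (hU : ∀ x, HasSum (fun p => A p * planeWave (dualPoint τ p) x) (U x))
    (hV : ∀ x, HasSum (fun p => B p * planeWave (dualPoint τ p) x) (V x)) :
    HasSum (fun p => A p * B (-p)) (⨍ x in cell τ, U x * V x) := by
  have hUV (x : ℂ) : HasSum (fun r : (ℤ × ℤ) × (ℤ × ℤ) =>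
      A r.1 * B r.2 * planeWave (dualPoint τ (r.1 + r.2)) x) (U x * V x) := by
    have hnorm {C : ℤ × ℤ → ℂ} (hC : Summable fun p => ‖C p‖) :
        Summable fun p => ‖C p * planeWave (dualPoint τ p) x‖ := by
      simpa only [norm_mul, norm_planeWave, mul_one] using hC
    refine ((hU x).mul (hV x) (summable_mul_of_summable_norm
      (f := fun p => A p * planeWave (dualPoint τ p) x)
      (g := fun p => B p * planeWave (dualPoint τ p) x) (hnorm hA) (hnorm hB))).congr_fun
      fun r => ?_
    rw [map_add, planeWave_add_left]
    ring
  have hsum := hasSum_average_cell hτ (d := fun r : (ℤ × ℤ) × (ℤ × ℤ) => r.1 + r.2)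
    (hA.mul_norm hB) hUV
  refine hsum.prod_fiberwise fun p => ?_
  refine (hasSum_ite_eq (-p) (A p * B (-p))).congr_fun fun q => ?_
  simp only [add_eq_zero_iff_neg_eq]
  split_ifs <;> simp_all

end Means

section Theta

theorem intervalIntegral_add_eq_of_periodic {h : ℂ → ℂ} (hd : Differentiable ℂ h)
    (hp : Function.Periodic h 1) (w : ℂ) :
    ∫ t in (0 : ℝ)..1, h (t + w) = ∫ t in (0 : ℝ)..1, h t := by
  have hvert (y : ℝ) : h (1 + y * I) = h (y * I) := by rw [add_comm, hp]
  have hrect : ∫ t in (0 : ℝ)..1, h (t + w.im * I) = ∫ t in (0 : ℝ)..1, h t := by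
    have hcauchy := integral_boundary_rect_eq_zero_of_differentiableOn h 0 (1 + w.im * I)
      hd.differentiableOn
    exact (sub_eq_zero.1 (by simpa [hvert] using hcauchy)).symm
  have hper : Function.Periodic (fun t : ℝ => h (t + w.im * I)) 1 := fun t => by
    beta_reduce
    rw [ofReal_add, ofReal_one, add_right_comm, hp]
  calc ∫ t in (0 : ℝ)..1, h (t + w)
    _ = ∫ t in (0 : ℝ)..1, h ((t + w.re : ℝ) + w.im * I) := by
      simp only [ofReal_add, add_assoc, re_add_im]
    _ = ∫ t in w.re..w.re + 1, h (t + w.im * I) := by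
      rw [intervalIntegral.integral_comp_add_right (fun t : ℝ => h (t + w.im * I)), zero_add,
        add_comm 1]
    _ = ∫ t in (0 : ℝ)..1, h (t + w.im * I) := by rw [hper.intervalIntegral_add_eq w.re 0, zero_add]
    _ = ∫ t in (0 : ℝ)..1, h t := hrect

theorem hasSum_fourierIntegral {g : ℝ → ℂ} (hg : Continuous g) (hp : Function.Periodic g 1)
    {c : ℤ → ℂ} (hc : ∀ n : ℤ, ∫ t in (0 : ℝ)..1, exp (-(2 * π * I * n * t)) * g t = c n)
    (hs : Summable c) (t : ℝ) : HasSum (fun n : ℤ => c n * exp (2 * π * I * n * t)) (g t) := by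
  have : Fact (0 < (1 : ℝ)) := ⟨one_pos⟩
  let G : C(AddCircle (1 : ℝ), ℂ) := ⟨hp.lift, continuous_coinduced_dom.2 hg⟩
  have hcoeff : fourierCoeff G = c := by
    funext n
    rw [fourierCoeff_eq_intervalIntegral _ n 0, ← hc, zero_add, one_div, inv_one, one_smul]
    refine intervalIntegral.integral_congr fun t _ => ?_
    change fourier (-n) (t : AddCircle (1 : ℝ)) • g t = _
    rw [fourier_coe_apply, smul_eq_mul, ofReal_one, div_one, Int.cast_neg, mul_neg, neg_mul]
  have hsum := has_pointwise_sum_fourier_series_of_summable (hcoeff ▸ hs) (t : AddCircle (1 : ℝ))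
  simp only [hcoeff, fourier_coe_apply, smul_eq_mul, ofReal_one, div_one] at hsum
  exact hsum

variable {Θ : ℂ → ℂ} {τ : ℂ}

theorem fourierIntegral_add (hd : Differentiable ℂ Θ) (h₁ : Function.Periodic Θ 1) (n : ℤ)
    (w : ℂ) :
    ∫ t in (0 : ℝ)..1, exp (-(2 * π * I * n * t)) * Θ (t + w)
      = exp (2 * π * I * n * w) * ∫ t in (0 : ℝ)..1, exp (-(2 * π * I * n * t)) * Θ t := by
  have hper : Function.Periodic (fun z => exp (-(2 * π * I * n * z)) * Θ z) 1 := fun z => by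
    beta_reduce
    rw [h₁, exp_eq_exp_iff_exists_int.2 ⟨-n, ?_⟩]
    push_cast
    ring
  rw [← intervalIntegral_add_eq_of_periodic (by fun_prop) hper w,
    ← intervalIntegral.integral_const_mul]
  refine intervalIntegral.integral_congr fun t _ => ?_
  rw [← mul_assoc, ← exp_add]
  ring_nf

theorem fourierIntegral_eq_exp_mul (hd : Differentiable ℂ Θ) (h₁ : Function.Periodic Θ 1)
    (hquasi : ∀ z, Θ (z + τ) = exp (-π * I * (τ + 2 * z)) * Θ z) (n : ℤ) :
    ∫ t in (0 : ℝ)..1, exp (-(2 * π * I * n * t)) * Θ t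
      = exp (π * I * n ^ 2 * τ) * ∫ t in (0 : ℝ)..1, Θ t := by
  set c : ℤ → ℂ := fun n => ∫ t in (0 : ℝ)..1, exp (-(2 * π * I * n * t)) * Θ t with hc
  have hrec (n : ℤ) : exp (2 * π * I * n * τ) * c n = exp (-(π * I * τ)) * c (n + 1) := by
    rw [hc, ← fourierIntegral_add hd h₁, ← intervalIntegral.integral_const_mul]
    refine intervalIntegral.integral_congr fun t _ => ?_
    rw [hquasi, ← mul_assoc, ← mul_assoc, ← exp_add, ← exp_add]
    push_cast
    ring_nf
  change c n = _
  induction n using Int.induction_on with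
  | zero => simp [hc]
  | succ n ih =>
    have h := hrec n
    rw [ih, ← mul_assoc, ← exp_add] at h
    rw [← mul_right_inj' (exp_ne_zero (-(π * I * τ))), ← h, ← mul_assoc, ← exp_add]
    push_cast
    ring_nf
  | pred n ih =>
    have h := hrec (-n - 1)
    rw [sub_add_cancel, ih, ← mul_assoc, ← exp_add] at h
    rw [← mul_right_inj' (exp_ne_zero (2 * π * I * (-n - 1 : ℤ) * τ)), h, ← mul_assoc, ← exp_add]
    push_cast
    ring_nf

theorem eq_integral_mul_jacobiTheta₂ (hτ : 0 < τ.im) (hd : Differentiable ℂ Θ)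
    (h₁ : Function.Periodic Θ 1)
    (hquasi : ∀ z, Θ (z + τ) = exp (-π * I * (τ + 2 * z)) * Θ z) (z : ℂ) :
    Θ z = (∫ t in (0 : ℝ)..1, Θ t) * jacobiTheta₂ z τ := by
  have hper : Function.Periodic (fun t : ℝ => Θ (t + z)) 1 := fun t => by
    beta_reduce
    rw [ofReal_add, ofReal_one, add_right_comm, h₁]
  have htheta := (hasSum_jacobiTheta₂_term z hτ).mul_left (∫ t in (0 : ℝ)..1, Θ t)
  have hfourier := hasSum_fourierIntegral (hd.continuous.comp (by fun_prop)) hper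
    (c := fun n => (∫ t in (0 : ℝ)..1, Θ t) * jacobiTheta₂_term n z τ) (fun n => ?_)
    htheta.summable 0
  · simpa using hfourier.unique (by simpa using htheta)
  · simp only [Function.comp_def]
    rw [fourierIntegral_add hd h₁, fourierIntegral_eq_exp_mul hd h₁ hquasi, jacobiTheta₂_term,
      exp_add]
    ring

theorem jacobiTheta₂_add_lattice (z τ : ℂ) (m n : ℤ) :
    jacobiTheta₂ (z + (m + n * τ)) τ
      = exp (-(π * I * n ^ 2 * τ + 2 * π * I * n * z)) * jacobiTheta₂ z τ := by
  rw [jacobiTheta₂, jacobiTheta₂, ← Equiv.tsum_eq (Equiv.addRight n) (fun j =>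
    jacobiTheta₂_term j z τ), ← tsum_mul_left]
  refine tsum_congr fun j => ?_
  rw [jacobiTheta₂_term, jacobiTheta₂_term, ← exp_add, exp_eq_exp_iff_exists_int]
  refine ⟨j * m, ?_⟩
  simp only [Equiv.coe_addRight]
  push_cast
  ring

/-- The change of summation indices `(m, n) ↦ (n, m - n)`. -/
def shear : ℤ × ℤ ≃ ℤ × ℤ where
  toFun q := (q.2, q.1 - q.2)
  invFun q := (q.1 + q.2, q.1)
  left_inv q := by simp
  right_inv q := by simp

theorem jacobiTheta₂_mul_jacobiTheta₂ {σ : ℂ} (hτ : 0 < τ.im) (hσ : 0 < σ.im) (z w : ℂ) :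
    jacobiTheta₂ z τ * jacobiTheta₂ w σ
      = ∑' m : ℤ, exp (2 * π * I * m * w + π * I * m ^ 2 * σ)
        * jacobiTheta₂ (z - w - m * σ) (τ + σ) := by
  have hz := ((summable_jacobiTheta₂_term_iff z τ).2 hτ).norm
  have hw := ((summable_jacobiTheta₂_term_iff w σ).2 hσ).norm
  rw [jacobiTheta₂, jacobiTheta₂, tsum_mul_tsum_of_summable_norm hz hw]
  have hs : Summable fun q =>
      jacobiTheta₂_term (shear q).1 z τ * jacobiTheta₂_term (shear q).2 w σ :=
    shear.summable_iff.2 (summable_mul_of_summable_norm hz hw)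
  rw [← shear.tsum_eq, Summable.tsum_prod hs]
  refine tsum_congr fun m => ?_
  rw [jacobiTheta₂, ← tsum_mul_left]
  refine tsum_congr fun n => ?_
  simp only [shear, Equiv.coe_fn_mk, jacobiTheta₂_term, ← exp_add]
  congr 1
  push_cast
  ring

theorem sqrt_mul_jacobiTheta₂_eq_tsum_gaussian {r : ℝ} (hr : 0 < r) (ζ : ℂ) :
    √r * jacobiTheta₂ ζ (I * r) = ∑' l : ℤ, exp (-(π * (ζ - l) ^ 2 / r)) := by
  have hr' : (r : ℂ) ≠ 0 := by exact_mod_cast hr.ne'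
  have hcpow : (-I * (I * r)) ^ (1 / 2 : ℂ) = (√r : ℂ) := by
    rw [← mul_assoc, neg_mul, I_mul_I, neg_neg, one_mul, Real.sqrt_eq_rpow,
      ofReal_cpow hr.le]
    norm_num
  have hsqrt : (√r : ℂ) ≠ 0 := by exact_mod_cast (Real.sqrt_pos.2 hr).ne'
  rw [jacobiTheta₂_functional_equation, hcpow, mul_assoc (1 / _), ← mul_assoc,
    mul_one_div_cancel hsqrt, one_mul, jacobiTheta₂, ← tsum_mul_left]
  refine tsum_congr fun l => ?_
  rw [jacobiTheta₂_term, ← exp_add]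
  congr 1
  field_simp
  ring

end Theta
section BlochFunctions

/-- The lowest Landau level function `e^{(x² - |x|²) / 4}`, whose magnetic translates have
holomorphic multipliers. -/
noncomputable def landauFactor (x : ℂ) : ℂ := exp ((x ^ 2 - (‖x‖ ^ 2 : ℝ)) / 4)

/-- The function on the plane given by a function `Θ` of the coordinate in which the lattice is
`ℤ + τ ℤ`. -/
noncomputable def landauFunction (τ : ℂ) (Θ : ℂ → ℂ) (x : ℂ) : ℂ :=
  landauFactor x * Θ (x / scale τ)

/-- The normalized solution `φ₀` with quasimomentum zero. -/
noncomputable def thetaSolution (τ : ℂ) : ℂ → ℂ :=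
  (√(√(2 * τ.im)) : ℂ) • landauFunction τ fun z => jacobiTheta₂ z τ

/-- The normalized solution `φ_k`, a magnetic translate of `φ₀`. -/
noncomputable def bloch (τ k : ℂ) : ℂ → ℂ := magneticTranslation (I * k) (thetaSolution τ)

variable {τ : ℂ}

theorem ofReal_normSq_eq (x : ℂ) : ((‖x‖ ^ 2 : ℝ) : ℂ) = conj x * x := by
  rw [conj_mul', ofReal_pow]

theorem ofReal_inner_eq (x y : ℂ) : ((inner ℝ x y : ℝ) : ℂ) = (conj x * y + x * conj y) / 2 := by
  rw [Complex.inner, re_eq_add_conj, map_mul, conj_conj]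
  ring

theorem exp_mul_normSq_mul_landauFactor (x : ℂ) :
    (Real.exp (1 / 4 * ‖x‖ ^ 2) : ℂ) * landauFactor x = exp (x ^ 2 / 4) := by
  rw [landauFactor, ofReal_exp, ← exp_add]
  congr 1
  push_cast
  ring

theorem landauFactor_ne_zero (x : ℂ) : landauFactor x ≠ 0 := exp_ne_zero _

theorem contDiff_landauFactor : ContDiff ℝ 2 landauFactor :=
  (((contDiff_id.pow 2).sub (ofRealCLM.contDiff.comp (contDiff_norm_sq ℝ))).div_const 4).cexp

theorem magneticTranslation_landauFactor (s x : ℂ) :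
    magneticTranslation s landauFactor x
      = exp ((s - conj s) * (2 * x + s) / 4) * landauFactor x := by
  rw [magneticTranslation, planeWave, landauFactor, landauFactor, ← exp_add, ← exp_add,
    ofReal_inner_eq, ofReal_normSq_eq, ofReal_normSq_eq, a0_eq]
  congr 1
  simp only [map_add, map_neg, map_mul, map_div₀, conj_I, map_ofNat]
  linear_combination (conj s * x - s * conj x) / 4 * I_sq

theorem neg_one_zpow_eq_exp (j : ℤ) : (-1 : ℂ) ^ j = exp (π * I * j) := by
  rw [mul_comm, exp_int_mul, exp_pi_mul_I]

theorem two_pi_eq (hτ : 0 < τ.im) : (2 * π : ℂ) = scale τ ^ 2 * τ.im := by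
  exact_mod_cast (scale_sq_mul_im hτ).symm

theorem ofReal_scale_ne_zero (hτ : 0 < τ.im) : (scale τ : ℂ) ≠ 0 := by
  exact_mod_cast (scale_pos hτ).ne'

theorem magneticTranslation_point_landauFactor (hτ : 0 < τ.im) (m n : ℤ) (x : ℂ) :
    magneticTranslation (point τ m n) landauFactor x
      = (-1 : ℂ) ^ (m * n) * exp (π * I * n ^ 2 * τ + 2 * π * I * n * (x / scale τ))
        * landauFactor x := by
  have ha := ofReal_scale_ne_zero hτ
  have him : τ - conj τ = 2 * τ.im * I := by rw [sub_conj]; push_cast; ring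
  have hs : point τ m n - conj (point τ m n) = scale τ * n * (2 * τ.im * I) := by
    rw [← him, point_eq]
    simp only [map_add, map_mul, conj_ofReal]
    push_cast
    ring
  rw [magneticTranslation_landauFactor, neg_one_zpow_eq_exp, ← exp_add, hs, point_eq]
  congr 2
  field_simp
  push_cast
  linear_combination -(2 * n * (scale τ * (m + n * τ) + 2 * x)) * two_pi_eq hτ

theorem magneticTranslation_landauFunction (hτ : 0 < τ.im) (Θ : ℂ → ℂ) (m n : ℤ) (x : ℂ) :
    magneticTranslation (point τ m n) (landauFunction τ Θ) x
      = (-1 : ℂ) ^ (m * n) * landauFactor x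
        * (exp (π * I * n ^ 2 * τ + 2 * π * I * n * (x / scale τ))
          * Θ (x / scale τ + (m + n * τ))) := by
  have hx : (x + point τ m n) / scale τ = x / scale τ + (m + n * τ) := by
    rw [add_div, point_eq, mul_div_cancel_left₀ _ (ofReal_scale_ne_zero hτ)]
    push_cast
    rfl
  have hfactor := magneticTranslation_point_landauFactor hτ m n x
  rw [magneticTranslation] at hfactor
  rw [magneticTranslation, landauFunction, hx, ← mul_assoc, hfactor]
  ring

theorem isQuasiPeriodic_landauFunction_iff (hτ : 0 < τ.im) {Θ : ℂ → ℂ} :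
    IsQuasiPeriodic τ 0 (landauFunction τ Θ) ↔ ∀ (m n : ℤ) (z : ℂ),
      exp (π * I * n ^ 2 * τ + 2 * π * I * n * z) * Θ (z + (m + n * τ)) = Θ z := by
  have ha := ofReal_scale_ne_zero hτ
  refine forall₂_congr fun m n => funext_iff.trans ?_
  refine ((Equiv.mulRight₀ _ ha).forall_congr fun z => ?_).symm
  simp only [Equiv.mulRight₀_apply, magneticTranslation_landauFunction hτ,
    mul_div_cancel_right₀ _ ha, planeWave_zero_left, mul_one, Pi.smul_apply, smul_eq_mul,
    landauFunction, mul_assoc]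
  rw [mul_right_inj' (zpow_ne_zero _ (neg_ne_zero.2 one_ne_zero)),
    mul_right_inj' (landauFactor_ne_zero _)]

theorem annihilation_landauFunction_eq_zero_iff (hτ : 0 < τ.im) {Θ : ℂ → ℂ}
    (hd : Differentiable ℝ (landauFunction τ Θ)) :
    annihilation (landauFunction τ Θ) = 0 ↔ Differentiable ℂ Θ := by
  have ha := ofReal_scale_ne_zero hτ
  have hprod : (fun x => (Real.exp (1 / 4 * ‖x‖ ^ 2) : ℂ) * landauFunction τ Θ x)
      = fun x => exp (x ^ 2 / 4) * Θ (x / scale τ) := by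
    funext x
    rw [landauFunction, ← mul_assoc, exp_mul_normSq_mul_landauFactor]
  rw [annihilation_eq_zero_iff hd, hprod]
  refine ⟨fun h => ?_, fun h => by fun_prop⟩
  have hΘ : Θ = fun z => exp (-((z * scale τ) ^ 2 / 4))
      * ((fun x => exp (x ^ 2 / 4) * Θ (x / scale τ)) (z * scale τ)) := by
    funext z
    beta_reduce
    rw [← mul_assoc, ← exp_add, neg_add_cancel, exp_zero, one_mul, mul_div_cancel_right₀ _ ha]
  rw [hΘ]
  exact Differentiable.mul (by fun_prop) (h.comp (by fun_prop))

theorem differentiable_jacobiTheta₂ (hτ : 0 < τ.im) : Differentiable ℂ fun z => jacobiTheta₂ z τ :=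
  fun z => differentiableAt_jacobiTheta₂_fst z hτ

theorem contDiff_landauFunction {Θ : ℂ → ℂ} (hΘ : Differentiable ℂ Θ) :
    ContDiff ℝ 2 (landauFunction τ Θ) :=
  contDiff_landauFactor.mul ((hΘ.contDiff.restrict_scalars ℝ).comp (contDiff_id.div_const _))

theorem contDiff_thetaSolution (hτ : 0 < τ.im) : ContDiff ℝ 2 (thetaSolution τ) :=
  contDiff_const.smul (contDiff_landauFunction (differentiable_jacobiTheta₂ hτ))

theorem annihilation_thetaSolution (hτ : 0 < τ.im) : annihilation (thetaSolution τ) = 0 := by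
  have hd : Differentiable ℝ (landauFunction τ fun z => jacobiTheta₂ z τ) :=
    (contDiff_landauFunction (differentiable_jacobiTheta₂ hτ)).differentiable two_ne_zero
  rw [thetaSolution, annihilation_const_smul _ hd,
    (annihilation_landauFunction_eq_zero_iff hτ hd).2 (differentiable_jacobiTheta₂ hτ), smul_zero]

theorem isQuasiPeriodic_thetaSolution (hτ : 0 < τ.im) : IsQuasiPeriodic τ 0 (thetaSolution τ) := by
  have h := (isQuasiPeriodic_landauFunction_iff hτ (Θ := fun z => jacobiTheta₂ z τ)).2
    fun m n z => by rw [jacobiTheta₂_add_lattice, ← mul_assoc, ← exp_add, add_neg_cancel, exp_zero,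
      one_mul]
  intro m n
  rw [thetaSolution, magneticTranslation_const_smul, h m n, smul_comm]

theorem contDiff_bloch (hτ : 0 < τ.im) (k : ℂ) : ContDiff ℝ 2 (bloch τ k) :=
  contDiff_magneticTranslation _ (contDiff_thetaSolution hτ)

theorem annihilation_bloch (hτ : 0 < τ.im) (k : ℂ) : annihilation (bloch τ k) = 0 := by
  rw [bloch, annihilation_magneticTranslation _ ((contDiff_thetaSolution hτ).differentiable
    two_ne_zero), annihilation_thetaSolution hτ]
  exact funext fun _ => mul_zero _

theorem isQuasiPeriodic_bloch (hτ : 0 < τ.im) (k : ℂ) : IsQuasiPeriodic τ k (bloch τ k) := by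
  simpa only [zero_add, bloch] using (isQuasiPeriodic_thetaSolution hτ).magneticTranslation k

theorem bloch_zero (τ : ℂ) : bloch τ 0 = thetaSolution τ := by
  rw [bloch, mul_zero, magneticTranslation_zero]

theorem bloch_apply (τ k x : ℂ) :
    bloch τ k x = planeWave ((1 / 2 : ℝ) • k) x * thetaSolution τ (x + I * k) := by
  have hk : -a0 (I * k) = (1 / 2 : ℝ) • k := by
    rw [a0_eq, real_smul]
    push_cast
    linear_combination (-k / 2) * I_sq
  rw [bloch, magneticTranslation, hk]

variable {φ : ℂ → ℂ} {k : ℂ}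

theorem exists_eq_smul_thetaSolution (hτ : 0 < τ.im) (hd : Differentiable ℝ φ)
    (hann : annihilation φ = 0) (hφ : IsQuasiPeriodic τ 0 φ) :
    ∃ c : ℂ, φ = c • thetaSolution τ := by
  have ha := ofReal_scale_ne_zero hτ
  set Θ : ℂ → ℂ := fun z => φ (z * scale τ) / landauFactor (z * scale τ) with hΘ
  have hφΘ : φ = landauFunction τ Θ := by
    funext x
    simp only [landauFunction, hΘ]
    rw [div_mul_cancel₀ _ ha, mul_div_cancel₀ _ (landauFactor_ne_zero x)]
  rw [hφΘ] at hd hann hφ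
  have hquasi := (isQuasiPeriodic_landauFunction_iff hτ).1 hφ
  have hentire := (annihilation_landauFunction_eq_zero_iff hτ hd).1 hann
  obtain ⟨b, hb⟩ : ∃ b : ℂ, ∀ z, Θ z = b * jacobiTheta₂ z τ :=
    ⟨_, eq_integral_mul_jacobiTheta₂ hτ hentire (fun z => by simpa using hquasi 1 0 z)
      fun z => by
        rw [← hquasi 0 1 z, ← mul_assoc, ← exp_add]
        convert (one_mul _).symm using 2
        · rw [← exp_zero]
          push_cast
          ring_nf
        · simp⟩
  have hnorm : (√(√(2 * τ.im)) : ℂ) ≠ 0 := by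
    exact_mod_cast (Real.sqrt_pos.2 (Real.sqrt_pos.2 (by positivity))).ne'
  refine ⟨b / √(√(2 * τ.im)), ?_⟩
  rw [thetaSolution, smul_smul, div_mul_cancel₀ _ hnorm, hφΘ]
  funext x
  rw [landauFunction, hb]
  exact mul_left_comm _ _ _

theorem exists_eq_smul_bloch (hτ : 0 < τ.im) (hd : Differentiable ℝ φ)
    (hann : annihilation φ = 0) (hφ : IsQuasiPeriodic τ k φ) : ∃ c : ℂ, φ = c • bloch τ k := by
  have hd' : Differentiable ℝ (magneticTranslation (I * -k) φ) :=
    ((contDiff_planeWave _).differentiable two_ne_zero).mul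
      (hd.comp (differentiable_id.add_const _))
  obtain ⟨c, hc⟩ := exists_eq_smul_thetaSolution hτ hd'
    (by rw [annihilation_magneticTranslation _ hd, hann]; exact funext fun _ => mul_zero _)
    (by simpa only [add_neg_cancel] using hφ.magneticTranslation (-k))
  refine ⟨c, ?_⟩
  rw [bloch, ← magneticTranslation_const_smul, ← hc, mul_neg, magneticTranslation_neg]

end BlochFunctions
section Overlaps

variable {τ : ℂ}

/-- The Fourier coefficients of the lattice-periodic function `e^{-i k · x} φ̄₀ φ_k`, indexed by
the coordinates of the dual lattice points. -/
noncomputable def overlapCoeff (τ k : ℂ) (p : ℤ × ℤ) : ℂ :=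
  (-1 : ℂ) ^ (p.1 * p.2) * exp (((-(1 / 4) * ‖dualPoint τ p + k‖ ^ 2 : ℝ) : ℂ)
    + I * (((conj k * dualPoint τ p).im / 2 : ℝ) : ℂ))

theorem norm_overlapCoeff (τ k : ℂ) (p : ℤ × ℤ) :
    ‖overlapCoeff τ k p‖ = Real.exp (-(1 / 4) * ‖dualPoint τ p + k‖ ^ 2) := by
  rw [overlapCoeff, norm_mul, norm_zpow, norm_neg, norm_one, one_zpow, one_mul, exp_add, norm_mul,
    mul_comm I, norm_exp_ofReal_mul_I, mul_one, ← ofReal_exp, norm_real,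
    Real.norm_of_nonneg (Real.exp_pos _).le]

theorem summable_norm_overlapCoeff (hτ : 0 < τ.im) (k : ℂ) :
    Summable fun p => ‖overlapCoeff τ k p‖ := by
  simp only [norm_overlapCoeff]
  exact summable_exp_neg_mul_norm_dualPoint_add_sq hτ (by norm_num) k

theorem sqrt_mul_jacobiTheta₂_mul_conj (hτ : 0 < τ.im) (z w : ℂ) :
    √(2 * τ.im) * (jacobiTheta₂ z τ * conj (jacobiTheta₂ w τ))
      = ∑' (m : ℤ) (l : ℤ), exp (2 * π * I * m * conj w - π * I * m ^ 2 * conj τ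
        - π * (z - conj w + m * conj τ - l) ^ 2 / (2 * τ.im)) := by
  have hτ' : 0 < (-conj τ).im := by simpa using hτ
  have hsum : τ + -conj τ = I * (2 * τ.im : ℝ) := by
    rw [← sub_eq_add_neg, sub_conj, mul_comm]
  rw [jacobiTheta₂_conj, jacobiTheta₂_mul_jacobiTheta₂ hτ hτ', ← tsum_mul_left]
  refine tsum_congr fun m => ?_
  rw [hsum, mul_left_comm, sqrt_mul_jacobiTheta₂_eq_tsum_gaussian (by positivity), ← tsum_mul_left]
  refine tsum_congr fun l => ?_
  rw [← exp_add]
  congr 1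
  push_cast
  ring

/-- Completing the square in the exponents of the product of theta functions, for the dual lattice
point `t` with coordinates `(m, l)`. -/
theorem theta_exponent_eq (hτ : 0 < τ.im) (k x : ℂ) (m l : ℤ) :
    2 * π * I * m * conj (x / scale τ) - π * I * m ^ 2 * conj τ
        - π * ((x + I * k) / scale τ - conj (x / scale τ) + m * conj τ - l) ^ 2 / (2 * τ.im)
      = -(π * I * (m * l : ℤ)) + I * (dualPoint τ (m, l)).re * conj x
        - (dualPoint τ (m, l)).re * conj (dualPoint τ (m, l)) / 2
        - (x - conj x + I * k - I * conj (dualPoint τ (m, l))) ^ 2 / 4 := by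
  have ha := ofReal_scale_ne_zero hτ
  have him : (τ.im : ℂ) ≠ 0 := by exact_mod_cast hτ.ne'
  have hpi : (π : ℂ) = scale τ ^ 2 * τ.im / 2 := by rw [← two_pi_eq hτ]; ring
  have hre : ((dualPoint τ (m, l)).re : ℂ) = scale τ * m * τ.im := by
    have hre' : (dualPoint τ (m, l)).re = scale τ * m * τ.im := by
      simp [dualPoint_eq, mul_assoc]
    rw [hre']
    push_cast
    rfl
  rw [hre, dualPoint_eq, hpi]
  simp only [map_mul, map_sub, map_div₀, conj_I, conj_ofReal, map_intCast]
  field_simp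
  push_cast
  ring_nf
  simp only [I_sq, I_pow_three, I_pow_four]
  ring

theorem overlap_exponent_eq (k x t : ℂ) :
    -I * (inner ℝ k x : ℝ) / 2 + conj ((x ^ 2 - (‖x‖ ^ 2 : ℝ)) / 4)
        + ((x + I * k) ^ 2 - (‖x + I * k‖ ^ 2 : ℝ)) / 4
        + (I * t.re * conj x - t.re * conj t / 2 - (x - conj x + I * k - I * conj t) ^ 2 / 4)
      = (-(1 / 4) * ‖t + k‖ ^ 2 : ℝ) + I * ((conj k * t).im / 2 : ℝ) + I * (inner ℝ t x : ℝ) := by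
  have him : (((conj k * t).im : ℝ) : ℂ) = -I * (conj k * t - k * conj t) / 2 := by
    rw [im_eq_sub_conj, map_mul, conj_conj]
    field_simp
    linear_combination (conj k * t - k * conj t) * I_sq
  rw [ofReal_mul, ofReal_div, him, re_eq_add_conj]
  simp only [ofReal_normSq_eq, ofReal_inner_eq, map_div₀, map_sub, map_add, map_mul, map_pow,
    conj_I, conj_conj, map_ofNat]
  push_cast
  ring_nf
  simp only [I_sq]
  ring

theorem conj_thetaSolution_mul_bloch_eq (τ k x : ℂ) :
    planeWave (-k) x * conj (thetaSolution τ x) * bloch τ k x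
      = exp (-I * (inner ℝ k x : ℝ) / 2 + conj ((x ^ 2 - (‖x‖ ^ 2 : ℝ)) / 4)
          + ((x + I * k) ^ 2 - (‖x + I * k‖ ^ 2 : ℝ)) / 4)
        * (√(2 * τ.im) * (jacobiTheta₂ ((x + I * k) / scale τ) τ
          * conj (jacobiTheta₂ (x / scale τ) τ))) := by
  have hsqrt : (√(√(2 * τ.im)) : ℂ) * √(√(2 * τ.im)) = √(2 * τ.im) := by
    rw [← ofReal_mul, Real.mul_self_sqrt (Real.sqrt_nonneg _)]
  have hphase : planeWave (-k) x * planeWave ((1 / 2 : ℝ) • k) x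
      = exp (-I * (inner ℝ k x : ℝ) / 2) := by
    rw [planeWave, planeWave, ← exp_add, inner_neg_left, real_inner_smul_left]
    congr 1
    push_cast
    ring
  simp only [bloch_apply, thetaSolution, landauFunction, landauFactor, Pi.smul_apply, smul_eq_mul,
    map_mul, conj_ofReal, ← hsqrt, exp_add, exp_conj, ← hphase]
  ring

theorem hasSum_conj_thetaSolution_mul_bloch (hτ : 0 < τ.im) (k x : ℂ) :
    HasSum (fun p => overlapCoeff τ k p * planeWave (dualPoint τ p) x)
      (planeWave (-k) x * conj (thetaSolution τ x) * bloch τ k x) := by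
  have hs : Summable fun p => overlapCoeff τ k p * planeWave (dualPoint τ p) x := by
    refine Summable.of_norm ?_
    simpa only [norm_mul, norm_planeWave, mul_one] using summable_norm_overlapCoeff hτ k
  convert hs.hasSum using 1
  rw [conj_thetaSolution_mul_bloch_eq, sqrt_mul_jacobiTheta₂_mul_conj hτ, hs.tsum_prod,
    ← tsum_mul_left]
  refine tsum_congr fun m => ?_
  rw [← tsum_mul_left]
  refine tsum_congr fun l => ?_
  have hsign : (-1) ^ (m * l) = exp (-(π * I * (m * l : ℤ))) := by
    rw [exp_neg, ← neg_one_zpow_eq_exp, ← inv_zpow, inv_neg_one]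
  rw [overlapCoeff, planeWave, hsign, ← exp_add, ← exp_add, ← exp_add]
  congr 1
  linear_combination theta_exponent_eq hτ k x m l + overlap_exponent_eq k x (dualPoint τ (m, l))

end Overlaps
section GaussianSums

variable {τ : ℂ}

theorem overlapCoeff_zero (τ : ℂ) (p : ℤ × ℤ) :
    overlapCoeff τ 0 p = (-1) ^ (p.1 * p.2) * (Real.exp (-(1 / 4) * ‖dualPoint τ p‖ ^ 2) : ℂ) := by
  rw [overlapCoeff, add_zero, map_zero, zero_mul, zero_im, zero_div, ofReal_zero, mul_zero,
    add_zero, ofReal_exp]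

theorem overlapCoeff_neg_neg (τ k : ℂ) (p : ℤ × ℤ) :
    overlapCoeff τ (-k) (-p) = overlapCoeff τ k p := by
  rw [overlapCoeff, overlapCoeff, Prod.fst_neg, Prod.snd_neg, neg_mul_neg, map_neg, map_neg,
    neg_mul_neg, ← neg_add, norm_neg]

theorem neg_one_zpow_mul_self (j : ℤ) : (-1 : ℂ) ^ j * (-1) ^ j = 1 := by
  rw [← mul_zpow, neg_mul_neg, one_mul, one_zpow]

theorem planeWave_I_mul (t k : ℂ) : planeWave t (I * k) = exp (I * ((conj k * t).im : ℝ)) := by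
  rw [planeWave, Complex.inner]
  congr 3
  simp only [mul_re, mul_im, conj_re, conj_im, I_re, I_im]
  ring

theorem hasSum_normSq_bloch (hτ : 0 < τ.im) (k x : ℂ) :
    HasSum (fun p => overlapCoeff τ 0 p * planeWave (dualPoint τ p) (I * k)
      * planeWave (dualPoint τ p) x) ((‖bloch τ k x‖ ^ 2 : ℝ) : ℂ) := by
  have h := hasSum_conj_thetaSolution_mul_bloch hτ 0 (x + I * k)
  rw [neg_zero, planeWave_zero_left, one_mul, bloch_zero, ← ofReal_normSq_eq] at h
  rw [bloch, norm_magneticTranslation]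
  refine h.congr_fun fun p => ?_
  rw [planeWave_add_right]
  ring

theorem summable_norm_overlapCoeff_mul_planeWave (hτ : 0 < τ.im) (k : ℂ) :
    Summable fun p => ‖overlapCoeff τ 0 p * planeWave (dualPoint τ p) (I * k)‖ := by
  simpa only [norm_mul, norm_planeWave, mul_one] using summable_norm_overlapCoeff hτ 0

theorem average_ofReal {α : Type*} [MeasurableSpace α] (μ : Measure α) (f : α → ℝ) :
    ⨍ x, (f x : ℂ) ∂μ = ((⨍ x, f x ∂μ : ℝ) : ℂ) := by
  rw [average, average, integral_complex_ofReal]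

theorem average_normSq_bloch (hτ : 0 < τ.im) (k : ℂ) : ⨍ x in cell τ, ‖bloch τ k x‖ ^ 2 = 1 := by
  have h := (hasSum_average_cell hτ (d := id) (summable_norm_overlapCoeff_mul_planeWave hτ k)
    (hasSum_normSq_bloch hτ k)).unique (hasSum_single 0 fun p hp => if_neg hp)
  rw [average_ofReal, if_pos rfl, overlapCoeff_zero, map_zero, planeWave_zero_left] at h
  simpa using h

theorem hasSum_average_normSq_mul_normSq_bloch (hτ : 0 < τ.im) (k : ℂ) :
    HasSum (fun t : dualLattice τ =>
        Real.exp (-(1 / 2) * ‖(t : ℂ)‖ ^ 2) * Real.cos (conj k * (t : ℂ)).im)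
      (⨍ x in cell τ, ‖bloch τ 0 x‖ ^ 2 * ‖bloch τ k x‖ ^ 2) := by
  have h := hasSum_average_cell_mul hτ (summable_norm_overlapCoeff_mul_planeWave hτ 0)
    (summable_norm_overlapCoeff_mul_planeWave hτ k) (hasSum_normSq_bloch hτ 0)
    (hasSum_normSq_bloch hτ k)
  simp only [← ofReal_mul, average_ofReal] at h
  rw [← (dualEquiv hτ).hasSum_iff]
  refine (hasSum_re h).congr_fun fun p => ?_
  have hsign := neg_one_zpow_mul_self (p.1 * p.2)
  have hterm : overlapCoeff τ 0 p * planeWave (dualPoint τ p) (I * 0)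
      * (overlapCoeff τ 0 (-p) * planeWave (dualPoint τ (-p)) (I * k))
      = (Real.exp (-(1 / 2) * ‖dualPoint τ p‖ ^ 2) : ℂ)
        * exp (((-(conj k * dualPoint τ p).im : ℝ) : ℂ) * I) := by
    have hexp : -(1 / 2) * ‖dualPoint τ p‖ ^ 2
        = -(1 / 4) * ‖dualPoint τ p‖ ^ 2 + -(1 / 4) * ‖dualPoint τ p‖ ^ 2 := by ring
    rw [mul_zero, planeWave_zero_right, planeWave_I_mul, overlapCoeff_zero, overlapCoeff_zero,
      Prod.fst_neg, Prod.snd_neg, neg_mul_neg, map_neg, norm_neg, mul_neg, neg_im, mul_comm I,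
      hexp, Real.exp_add, ofReal_mul]
    linear_combination Real.exp (-(1 / 4) * ‖dualPoint τ p‖ ^ 2) ^ 2
      * exp (((-(conj k * dualPoint τ p).im : ℝ) : ℂ) * I) * hsign
  rw [hterm, re_ofReal_mul, exp_ofReal_mul_I_re, Real.cos_neg]
  rfl

theorem hasSum_average_norm_bloch_pow_four (hτ : 0 < τ.im) :
    HasSum (fun t : dualLattice τ => Real.exp (-(1 / 2) * ‖(t : ℂ)‖ ^ 2))
      (⨍ x in cell τ, ‖bloch τ 0 x‖ ^ 4) := by
  simpa only [map_zero, zero_mul, zero_im, Real.cos_zero, mul_one, ← pow_add] using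
    hasSum_average_normSq_mul_normSq_bloch hτ 0

theorem hasSum_average_sq_conj_bloch_mul (hτ : 0 < τ.im) (k : ℂ) :
    HasSum (fun t : dualLattice τ => exp (((-(1 / 2) * ‖(t : ℂ) + k‖ ^ 2 : ℝ) : ℂ)
        + I * (((conj k * (t : ℂ)).im : ℝ) : ℂ)))
      (⨍ x in cell τ, conj (bloch τ 0 x) ^ 2 * bloch τ k x * bloch τ (-k) x) := by
  have h := hasSum_average_cell_mul hτ (summable_norm_overlapCoeff hτ k)
    (summable_norm_overlapCoeff hτ (-k)) (hasSum_conj_thetaSolution_mul_bloch hτ k)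
    (hasSum_conj_thetaSolution_mul_bloch hτ (-k))
  have hprod (x : ℂ) : planeWave (-k) x * conj (thetaSolution τ x) * bloch τ k x
      * (planeWave (- -k) x * conj (thetaSolution τ x) * bloch τ (-k) x)
      = conj (bloch τ 0 x) ^ 2 * bloch τ k x * bloch τ (-k) x := by
    rw [bloch_zero]
    linear_combination conj (thetaSolution τ x) ^ 2 * bloch τ k x * bloch τ (-k) x
      * planeWave_mul_planeWave_neg (-k) x
  simp only [hprod] at h
  rw [← (dualEquiv hτ).hasSum_iff]
  refine h.congr_fun fun p => ?_
  rw [overlapCoeff_neg_neg, overlapCoeff, mul_mul_mul_comm, neg_one_zpow_mul_self, one_mul,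
    ← exp_add, Function.comp_apply, coe_dualEquiv]
  congr 1
  push_cast
  ring

end GaussianSums

section NormalizedSolutions

variable {τ k : ℂ} {φ : ℂ → ℂ}

theorem IsNormalizedSolution.isQuasiPeriodic (h : IsNormalizedSolution τ k φ) :
    IsQuasiPeriodic τ k φ :=
  isQuasiPeriodic_iff.2 h.quasiPeriodic

theorem IsNormalizedSolution.annihilation_eq_zero (hτ : 0 < τ.im)
    (h : IsNormalizedSolution τ k φ) : annihilation φ = 0 := by
  have hd := differentiable_annihilation h.contDiff
  have hquasi : IsQuasiPeriodic τ k (annihilation φ) :=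
    h.isQuasiPeriodic.annihilation (h.contDiff.differentiable two_ne_zero)
  obtain ⟨C, hC⟩ := exists_norm_le_of_norm_add_point_eq hτ hd.continuous hquasi.norm_add
  refine eq_zero_of_creation_eq_zero hd (funext fun x => ?_) hC
  rw [creation_annihilation h.contDiff, Pi.zero_apply]
  linear_combination -h.eigen x

theorem isNormalizedSolution_bloch (hτ : 0 < τ.im) (k : ℂ) :
    IsNormalizedSolution τ k (bloch τ k) where
  contDiff := contDiff_bloch hτ k
  eigen x := by
    have h := creation_annihilation (contDiff_bloch hτ k) x
    have h₀ : creation (0 : ℂ → ℂ) x = 0 := by simp [creation, covDeriv]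
    rw [annihilation_bloch hτ, h₀] at h
    linear_combination h
  quasiPeriodic := isQuasiPeriodic_iff.1 (isQuasiPeriodic_bloch hτ k)
  normalized := average_normSq_bloch hτ k

theorem IsNormalizedSolution.exists_eq_smul_bloch (hτ : 0 < τ.im)
    (h : IsNormalizedSolution τ k φ) : ∃ c : ℂ, ‖c‖ = 1 ∧ φ = c • bloch τ k := by
  obtain ⟨c, rfl⟩ := Abrikosov.exists_eq_smul_bloch hτ (h.contDiff.differentiable two_ne_zero)
    (h.annihilation_eq_zero hτ) h.isQuasiPeriodic
  refine ⟨c, ?_, rfl⟩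
  have hnorm : ⨍ x in cell τ, ‖(c • bloch τ k) x‖ ^ 2 = ‖c‖ ^ 2 := by
    simp only [Pi.smul_apply, norm_smul, mul_pow, average, integral_const_mul]
    rw [← average, average_normSq_bloch hτ, mul_one]
  rwa [h.normalized, eq_comm, pow_eq_one_iff_of_nonneg (norm_nonneg c) two_ne_zero] at hnorm

theorem IsNormalizedSolution.exists_eq_mul (hτ : 0 < τ.im) {ψ : ℂ → ℂ}
    (hφ : IsNormalizedSolution τ k φ) (hψ : IsNormalizedSolution τ k ψ) :
    ∃ c : ℂ, ‖c‖ = 1 ∧ ∀ x, ψ x = c * φ x := by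
  obtain ⟨c, hc, rfl⟩ := hφ.exists_eq_smul_bloch hτ
  obtain ⟨d, hd, rfl⟩ := hψ.exists_eq_smul_bloch hτ
  refine ⟨d / c, by rw [norm_div, hc, hd, div_one], fun x => ?_⟩
  have hc₀ : c ≠ 0 := norm_ne_zero_iff.1 (hc ▸ one_ne_zero)
  rw [Pi.smul_apply, Pi.smul_apply, smul_eq_mul, smul_eq_mul, ← mul_assoc, div_mul_cancel₀ _ hc₀]

theorem gammaK_eq_gammaK_bloch (hτ : 0 < τ.im) {φ : ℂ → ℂ → ℂ}
    (hφ : ∀ k, IsNormalizedSolution τ k (φ k)) (k : ℂ) :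
    gammaK τ φ k = gammaK τ (bloch τ) k := by
  choose c hc hφc using fun k => (hφ k).exists_eq_smul_bloch hτ
  obtain rfl : φ = fun k => c k • bloch τ k := funext hφc
  have hmixed (x : ℂ) : (c 0 * bloch τ 0 x) ^ 2 * conj (c k * bloch τ k x)
      * conj (c (-k) * bloch τ (-k) x) = c 0 ^ 2 * conj (c k) * conj (c (-k))
        * (bloch τ 0 x ^ 2 * conj (bloch τ k x) * conj (bloch τ (-k) x)) := by
    rw [map_mul, map_mul]
    ring
  simp only [gammaK, Pi.smul_apply, smul_eq_mul, norm_mul, hc, one_mul, hmixed, average,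
    integral_const_mul, norm_pow, RCLike.norm_conj, one_pow]

theorem gammaK_bloch (hτ : 0 < τ.im) (k : ℂ) :
    gammaK τ (bloch τ) k =
      2 * (∑' t : dualLattice τ,
        Real.exp (-(1 / 2) * ‖(t : ℂ)‖ ^ 2) * Real.cos (conj k * (t : ℂ)).im)
      + ‖∑' t : dualLattice τ, exp (((-(1 / 2) * ‖(t : ℂ) + k‖ ^ 2 : ℝ) : ℂ)
          + I * (((conj k * (t : ℂ)).im : ℝ) : ℂ))‖
      - ∑' t : dualLattice τ, Real.exp (-(1 / 2) * ‖(t : ℂ)‖ ^ 2) := by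
  have hmixed : ‖⨍ x in cell τ, bloch τ 0 x ^ 2 * conj (bloch τ k x) * conj (bloch τ (-k) x)‖
      = ‖⨍ x in cell τ, conj (bloch τ 0 x) ^ 2 * bloch τ k x * bloch τ (-k) x‖ := by
    rw [← RCLike.norm_conj, average, average, ← integral_conj]
    simp only [map_mul, map_pow, conj_conj]
  rw [gammaK, hmixed, (hasSum_average_normSq_mul_normSq_bloch hτ k).tsum_eq,
    (hasSum_average_sq_conj_bloch_mul hτ k).tsum_eq,
    (hasSum_average_norm_bloch_pow_four hτ).tsum_eq]

end NormalizedSolutions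

end Abrikosov

/-- The normalized solutions `φ_k` exist and are unique up to a constant phase, and for any choice
of them `γ_k(τ)` is given by the (convergent) sums over the dual lattice. -/
theorem theorem1p4 (τ : ℂ) (hτ : 0 < τ.im) :
    (∀ k : ℂ, (∃ φ : ℂ → ℂ, Abrikosov.IsNormalizedSolution τ k φ) ∧
      ∀ φ ψ : ℂ → ℂ, Abrikosov.IsNormalizedSolution τ k φ → Abrikosov.IsNormalizedSolution τ k ψ →
        ∃ c : ℂ, ‖c‖ = 1 ∧ ∀ x, ψ x = c * φ x) ∧
    (∀ k : ℂ,
      Summable (fun t : Abrikosov.dualLattice τ => Real.exp (-(1 / 2) * ‖(t : ℂ)‖ ^ 2)) ∧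
      Summable (fun t : Abrikosov.dualLattice τ =>
        Real.exp (-(1 / 2) * ‖(t : ℂ)‖ ^ 2) * Real.cos (conj k * (t : ℂ)).im) ∧
      Summable (fun t : Abrikosov.dualLattice τ =>
        Complex.exp (((-(1 / 2) * ‖(t : ℂ) + k‖ ^ 2 : ℝ) : ℂ)
          + Complex.I * (((conj k * (t : ℂ)).im : ℝ) : ℂ)))) ∧
    (∀ φ : ℂ → ℂ → ℂ, (∀ k, Abrikosov.IsNormalizedSolution τ k (φ k)) → ∀ k : ℂ,
      Abrikosov.gammaK τ φ k =
        2 * (∑' t : Abrikosov.dualLattice τ,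
          Real.exp (-(1 / 2) * ‖(t : ℂ)‖ ^ 2) * Real.cos (conj k * (t : ℂ)).im)
        + ‖∑' t : Abrikosov.dualLattice τ,
            Complex.exp (((-(1 / 2) * ‖(t : ℂ) + k‖ ^ 2 : ℝ) : ℂ)
              + Complex.I * (((conj k * (t : ℂ)).im : ℝ) : ℂ))‖
        - ∑' t : Abrikosov.dualLattice τ, Real.exp (-(1 / 2) * ‖(t : ℂ)‖ ^ 2)) := by
  refine ⟨fun k => ⟨⟨_, Abrikosov.isNormalizedSolution_bloch hτ k⟩, fun _ _ hφ hψ => ?_⟩,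
    fun k => ⟨?_, ?_, ?_⟩, fun φ hφ k => ?_⟩
  · exact hφ.exists_eq_mul hτ hψ
  · exact (Abrikosov.hasSum_average_norm_bloch_pow_four hτ).summable
  · exact (Abrikosov.hasSum_average_normSq_mul_normSq_bloch hτ k).summable
  · exact (Abrikosov.hasSum_average_sq_conj_bloch_mul hτ k).summable
  · rw [Abrikosov.gammaK_eq_gammaK_bloch hτ hφ, Abrikosov.gammaK_bloch hτ]
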